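/- Let $A=\mathbb F_q[\theta]$, $K=\mathbb F_q(\theta)$, let $A_+\subset A$ be the set of monic polynomials, and write $\deg=\deg_\theta$ with $\deg 0=-\infty$. Let $\tau$ be the $q$-th power Frobenius and let $\phi:A\to A[\tau]$ be a Drinfeld module of rank $r\ge 1$, given by $\phi_\theta=\theta+\kappa_1\tau+\dots+\kappa_r\tau^r$ with $\kappa_i\in A$, $\kappa_r\ne 0$. For an irreducible $f\in A_+$ of degree $d$ put $\mathbb F_f=A/(f)$, let $\bar\phi:A\to\mathbb F_f[\tau]$ be the reduction of $\phi$ modulo $f$, and let $r_0\le r$ be its rank, i.e. the largest $i\in\{1,\dots,r\}$ with $f\nmid\kappa_i$, or $0$ if there is none. If $r_0\ge1$, let $P_f(x)=x^{r_0}+a_{r_0-1}x^{r_0-1}+\dots+a_0\in A[x]$ be the characteristic polynomial of $\tau^d$ acting on the Tate module $T_\lambda(\bar\phi)=\varprojlim_n\bar\phi[\lambda^n](\overline{\mathbb F}_f)$, for $\lambda\in A_+$ irreducible, $\lambda\ne f$; it has coefficients in $A$, does not depend on $\lambda$, and $a_0=c_f^{-1}f$ for some $c_f\in\mathbb F_q^\times$.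 If $r_0=0$, let $P_f=1$. Put $b_\ell=-c_fa_\ell$ for $1\le\ell\le r_0-1$, $b_{r_0}=-c_f$ (if $r_0\ge 1$), and $b_\ell=0$ for $r_0<\ell\le r$. Let $Q_f^\vee(x)=P_f(x)/P_f(0)$, and define $\mu:A_+\to A$ by the formal Dirichlet series expansion $$L(\phi^\vee,s-1)=\prod_f Q_f^\vee\bigl(f^{-(s-1)}\bigr)^{-1}=\sum_{a\in A_+}\frac{\mu(a)}{a^s},$$ the product running over all irreducible $f\in A_+$. Set $\mu(b)=0$ for $b\in K\setminus A_+$. Then the objects above are well defined (in particular $\mu$ takes values in $A$), and the following hold for every irreducible $f\in A_+$, with $d$ and $r_0$ as above. (a) $\mu$ is multiplicative: $\mu(1)=1$ and $\mu(ab)=\mu(a)\mu(b)$ for coprime $a,b\in A_+$. (b) For any integer $m>-r$, $$\mu(f^{m+r})=\mu(f)\,\mu(f^{m+r-1})+\sum_{\ell=2}^{r}b_\ell f^{\ell-1}\mu(f^{m+r-\ell}).$$ (c) For any $a\in A_+$, $$\mu(fa)=\mu(f)\,\mu(a)+\sum_{\ell=2}^{r}b_\ell f^{\ell-1}\mu\!\left(\frac{a}{f^{\ell-1}}\right).$$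 (d) For any $m\ge1$: $\deg\mu(f^m)\le\bigl(1-\tfrac1{r_0}\bigr)md$ if $r_0\ge1$, and $\mu(f^m)=0$ if $r_0=0$. Moreover, for any $a\in A_+$, $\deg\mu(a)\le\bigl(1-\tfrac1r\bigr)\deg a$. -/

import Mathlib

open Polynomial

noncomputable section

namespace DrinfeldGoss

/-! ### Tate modules of modules over a commutative ring -/

section Tate

variable {R : Type*} [CommRing R]

/-- The sequences `(x 0, x 1, x 2, …)` in `M` with `x 0 = 0` and `p • x (n + 1) = x n`; then
`x n ∈ M[p ^ n]`. -/
def tateSubgroup (p : R) (M : Type*) [AddCommGroup M] [Module R M] : AddSubgroup (ℕ → M) where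
  carrier := {x | x 0 = 0 ∧ ∀ n, p • x (n + 1) = x n}
  zero_mem' := ⟨rfl, fun _ => smul_zero _⟩
  add_mem' := fun {a b} ha hb => ⟨by simp [ha.1, hb.1], fun n => by
    simp [smul_add, ha.2 n, hb.2 n]⟩
  neg_mem' := fun {a} ha => ⟨by simp [ha.1], fun n => by simp [ha.2 n]⟩

/-- The Tate module `T_p(M) = lim M[p ^ n]` (transition maps: multiplication by `p`). -/
abbrev TateModule (p : R) (M : Type*) [AddCommGroup M] [Module R M] : Type _ :=
  tateSubgroup p M

/-- The `p`-adic completion `R_p = lim R / (p ^ n)`. -/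
abbrev Completion (p : R) : Type _ := AdicCompletion (Ideal.span {p}) R

namespace TateModule

variable {p : R} {M : Type*} [AddCommGroup M] [Module R M]

theorem ext {x y : TateModule p M} (h : ∀ n, x.1 n = y.1 n) : x = y :=
  Subtype.ext (funext h)

theorem add_val (x y : TateModule p M) (n : ℕ) : (x + y).1 n = x.1 n + y.1 n := rfl

theorem zero_val (n : ℕ) : (0 : TateModule p M).1 n = 0 := rfl

theorem pow_smul_val (x : TateModule p M) (n : ℕ) : p ^ n • x.1 n = 0 := by
  induction n with
  | zero => simp [x.2.1]
  | succ n ih => rw [pow_succ, mul_smul, x.2.2 n, ih]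

/-- A representative in `R` of the component in `R / (p ^ n)` of an element of `R_p`. -/
def rep (a : Completion p) (n : ℕ) : R :=
  (Ideal.Quotient.mk_surjective (AdicCompletion.evalₐ (Ideal.span {p}) n a)).choose

theorem mk_rep (a : Completion p) (n : ℕ) :
    Ideal.Quotient.mk (Ideal.span {p} ^ n) (rep a n) = AdicCompletion.evalₐ _ n a :=
  (Ideal.Quotient.mk_surjective (AdicCompletion.evalₐ (Ideal.span {p}) n a)).choose_spec

/-- On `x n`, an element of `R` acts through its class modulo `p ^ n`. -/
theorem smul_val_congr (x : TateModule p M) (n : ℕ) {s t : R}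
    (h : Ideal.Quotient.mk (Ideal.span {p} ^ n) s = Ideal.Quotient.mk (Ideal.span {p} ^ n) t) :
    s • x.1 n = t • x.1 n := by
  rw [Ideal.Quotient.eq, Ideal.span_singleton_pow, Ideal.mem_span_singleton] at h
  obtain ⟨c, hc⟩ := h
  rw [← sub_eq_zero, ← sub_smul, hc, mul_comm, mul_smul, pow_smul_val, smul_zero]

theorem mk_rep_succ (a : Completion p) (n : ℕ) :
    Ideal.Quotient.mk (Ideal.span {p} ^ n) (rep a (n + 1)) =
      Ideal.Quotient.mk (Ideal.span {p} ^ n) (rep a n) := by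
  have h := congrArg (Ideal.Quotient.factor (Ideal.pow_le_pow_right (Nat.le_succ n)))
    (mk_rep a (n + 1))
  rw [mk_rep a n]
  rw [Ideal.Quotient.factor_mk] at h
  rw [h]
  obtain ⟨x, rfl⟩ := AdicCompletion.mk_surjective (Ideal.span {p}) R a
  rw [AdicCompletion.evalₐ_mk, AdicCompletion.evalₐ_mk, Ideal.Quotient.factor_mk]
  exact AdicCompletion.Ideal.mk_eq_mk (Ideal.span {p}) (Nat.le_succ n) x

/-- `R_p` acts on the Tate module componentwise: the component in `R / (p ^ n)` acts on
`x n ∈ M[p ^ n]`. -/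
instance : SMul (Completion p) (TateModule p M) where
  smul a x := ⟨fun n => rep a n • x.1 n, by simp [x.2.1], fun n => by
    rw [smul_comm, x.2.2 n]
    exact smul_val_congr x n (mk_rep_succ a n)⟩

theorem smul_val (a : Completion p) (x : TateModule p M) (n : ℕ) :
    (a • x).1 n = rep a n • x.1 n := rfl

instance : Module (Completion p) (TateModule p M) where
  one_smul x := ext fun n => by
    rw [smul_val, smul_val_congr x n (t := 1) (by rw [mk_rep, map_one, map_one]), one_smul]
  mul_smul a b x := ext fun n => by
    rw [smul_val, smul_val, smul_val, smul_smul]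
    exact smul_val_congr x n (by rw [map_mul, mk_rep, mk_rep, mk_rep, map_mul])
  smul_zero a := ext fun n => by rw [smul_val, zero_val, smul_zero]
  smul_add a x y := ext fun n => by simp only [smul_val, add_val, smul_add]
  add_smul a b x := ext fun n => by
    rw [smul_val, add_val, smul_val, smul_val, ← add_smul]
    exact smul_val_congr x n (by rw [map_add, mk_rep, mk_rep, mk_rep, map_add])
  zero_smul x := ext fun n => by
    rw [smul_val, zero_val, smul_val_congr x n (t := 0) (by rw [mk_rep, map_zero, map_zero]),
      zero_smul]

/-- The `R_p`-linear endomorphism of the Tate module induced by an endomorphism of `M`. -/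
def map (g : M →ₗ[R] M) : TateModule p M →ₗ[Completion p] TateModule p M where
  toFun x := ⟨fun n => g (x.1 n), (congrArg g x.2.1).trans (map_zero g), fun n => by
    rw [← map_smul, x.2.2 n]⟩
  map_add' x y := ext fun n => map_add g _ _
  map_smul' a x := ext fun n => map_smul g _ _

end TateModule

end Tate

/-! ### Drinfeld modules over `A = 𝔽_q[θ]` and their reductions -/

/-- A Drinfeld `A`-module `φ : A → A[τ]` of rank `r` over `A = F[θ]`, given by
`φ_θ = θ + κ₁ τ + ⋯ + κ_r τ ^ r` with `κ_r ≠ 0`. As `A = F[θ]`, the `F`-algebra homomorphism `φ`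
is determined by `φ_θ`, which is recorded by its coefficients `κ₀ = θ, κ₁, …, κ_r, 0, 0, …`. -/
structure DrinfeldModule (F : Type*) [Field F] (r : ℕ) where
  /-- The coefficient of `τ ^ i` in `φ_θ`. -/
  kappa : ℕ → F[X]
  kappa_zero : kappa 0 = X
  kappa_rank_ne_zero : kappa r ≠ 0
  kappa_eq_zero : ∀ i, r < i → kappa i = 0

/-- The primes of `A = F[θ]`: monic irreducible polynomials. -/
abbrev MonicPrime (F : Type*) [Field F] : Type _ := {f : F[X] // f.Monic ∧ Irreducible f}

instance (F : Type*) [Field F] (f : MonicPrime F) : Fact (Irreducible f.1) := ⟨f.2.2⟩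

section

variable {F : Type*} [Field F] [Fintype F] {r : ℕ}

/-- The `q`-th power Frobenius `τ` of an `F`-algebra `L`, where `q = #F`, as an `F`-linear map. -/
def tau (F : Type*) [Field F] [Fintype F] (L : Type*) [CommRing L] [Algebra F L] :
    Module.End F L :=
  (FiniteField.frobeniusAlgHom F L).toLinearMap

theorem tau_pow_apply (L : Type*) [CommRing L] [Algebra F L] (i : ℕ) (y : L) :
    (tau F L ^ i) y = y ^ (Fintype.card F ^ i) := by
  induction i generalizing y with
  | zero => simp
  | succ i ih =>
    rw [pow_succ, Module.End.mul_apply, ih, pow_succ', pow_mul]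
    rfl

/-- The operator `y ↦ θ y + κ₁ y ^ q + ⋯ + κ_r y ^ (q ^ r)` by which `φ_θ` acts on an `A`-algebra
`L` with structure map `ι`. -/
def DrinfeldModule.thetaAction (φ : DrinfeldModule F r) {L : Type*} [CommRing L] [Algebra F L]
    (ι : F[X] →ₐ[F] L) : Module.End F L :=
  ∑ i ∈ Finset.range (r + 1), LinearMap.mulLeft F (ι (φ.kappa i)) * tau F L ^ i

/-- An algebraic closure of the residue field `𝔽_f = A / (f)`. -/
abbrev ResidueClosure (f : MonicPrime F) : Type _ := AlgebraicClosure (AdjoinRoot f.1)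

/-- The structure map `A → A / (f) → 𝔽̄_f`. -/
def redMap (f : MonicPrime F) : F[X] →ₐ[F] ResidueClosure f :=
  (IsScalarTower.toAlgHom F (AdjoinRoot f.1) (ResidueClosure f)).comp (AdjoinRoot.mkₐ f.1)

/-- The `A`-module `φ̄(𝔽̄_f)`: the algebraic closure of `𝔽_f`, on which `θ` acts through the
reduction `φ̄_θ` of `φ_θ` modulo `f`. -/
abbrev DrinfeldModule.Reduced (φ : DrinfeldModule F r) (f : MonicPrime F) : Type _ :=
  Module.AEval' (φ.thetaAction (redMap f))

theorem redMap_pow (f : MonicPrime F) (a : F[X]) :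
    redMap f a ^ (Fintype.card F ^ f.1.natDegree) = redMap f a := by
  have hfin : Module.Finite F (AdjoinRoot f.1) := f.2.1.finite_adjoinRoot
  have : Finite (AdjoinRoot f.1) := Module.finite_of_finite F
  have := Fintype.ofFinite (AdjoinRoot f.1)
  have hrank : Module.finrank F (AdjoinRoot f.1) = f.1.natDegree := by
    rw [(AdjoinRoot.powerBasis' f.2.1).finrank, AdjoinRoot.powerBasis'_dim]
  have hc : Fintype.card (AdjoinRoot f.1) = Fintype.card F ^ f.1.natDegree := by
    rw [Module.card_eq_pow_finrank (K := F), hrank]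
  have h := FiniteField.pow_card (AdjoinRoot.mk f.1 a)
  rw [hc] at h
  have h2 := congrArg (algebraMap (AdjoinRoot f.1) (ResidueClosure f)) h
  rw [map_pow] at h2
  exact h2

/-- The `q ^ d`-th power Frobenius `τ ^ d`, `d = deg f`, as an endomorphism of `φ̄(𝔽̄_f)`. -/
def DrinfeldModule.frob (φ : DrinfeldModule F r) (f : MonicPrime F) :
    φ.Reduced f →ₗ[F[X]] φ.Reduced f :=
  LinearMap.ofAEval _
    ((Module.AEval'.of (φ.thetaAction (redMap f))).toLinearMap ∘ₗ
      tau F (ResidueClosure f) ^ f.1.natDegree)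
    (fun m => by
      have key : (tau F (ResidueClosure f) ^ f.1.natDegree) (φ.thetaAction (redMap f) m) =
          φ.thetaAction (redMap f) ((tau F (ResidueClosure f) ^ f.1.natDegree) m) := by
        simp only [DrinfeldModule.thetaAction, LinearMap.sum_apply, map_sum, Module.End.mul_apply,
          LinearMap.mulLeft_apply]
        refine Finset.sum_congr rfl fun i _ => ?_
        rw [tau_pow_apply, mul_pow, redMap_pow, tau_pow_apply, tau_pow_apply, tau_pow_apply,
          ← pow_mul, ← pow_mul, mul_comm (Fintype.card F ^ i)]
      rw [LinearMap.comp_apply, LinearMap.comp_apply]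
      exact (congrArg _ key).trans (Module.AEval'.X_smul_of _ _).symm)

theorem DrinfeldModule.frob_of (φ : DrinfeldModule F r) (f : MonicPrime F)
    (y : ResidueClosure f) :
    φ.frob f (Module.AEval'.of _ y) =
      Module.AEval'.of _ (y ^ (Fintype.card F ^ f.1.natDegree)) := by
  rw [← tau_pow_apply]
  rfl

open Classical in
/-- The rank `r₀` of the reduction `φ̄` modulo `f`: the largest `i ≤ r` with `κ_i ≢ 0` modulo `f`,
and `0` if there is no such `i`. -/
def DrinfeldModule.rankAt (φ : DrinfeldModule F r) (f : MonicPrime F) : ℕ :=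
  Nat.findGreatest (fun i => ¬ f.1 ∣ φ.kappa i) r

/-- `P ∈ A[x]` is the characteristic polynomial of `τ ^ d` on the Tate module `T_λ(φ̄)`, which is
free of rank `r₀` over `A_λ`. -/
def DrinfeldModule.IsFrobCharpoly (φ : DrinfeldModule F r) (f lam : MonicPrime F)
    (P : F[X][X]) : Prop :=
  ∃ b : Module.Basis (Fin (φ.rankAt f)) (Completion lam.1) (TateModule lam.1 (φ.Reduced f)),
    (LinearMap.toMatrix b b (TateModule.map (φ.frob f))).charpoly =
      P.map (algebraMap F[X] (Completion lam.1))

open Classical in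
/-- The polynomial `P_f ∈ A[x]`: the characteristic polynomial of `τ ^ d` acting on `T_λ(φ̄)` for
the primes `λ ≠ f` if `r₀ ≥ 1`, and `P_f = 1` if `r₀ = 0`. -/
def DrinfeldModule.charpolyAt (φ : DrinfeldModule F r) (f : MonicPrime F) : F[X][X] :=
  if 1 ≤ φ.rankAt f then
    Classical.epsilon fun P => ∀ lam : MonicPrime F, lam ≠ f → φ.IsFrobCharpoly f lam P
  else 1

/-- The constant `c_f ∈ F` in `P_f(0) = c_f⁻¹ f`, read off from leading coefficients (`f` is
monic). -/
def DrinfeldModule.constAt (φ : DrinfeldModule F r) (f : MonicPrime F) : F :=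
  ((φ.charpolyAt f).coeff 0).leadingCoeff⁻¹

/-- The coefficients `b_ℓ ∈ A` (for `ℓ ≥ 1`), where `P_f = x ^ r₀ + a_{r₀-1} x ^ (r₀-1) + ⋯ + a₀`:
`b_ℓ = - c_f a_ℓ` for `ℓ < r₀`, `b_{r₀} = - c_f`, and `b_ℓ = 0` for `ℓ > r₀`. -/
def DrinfeldModule.b (φ : DrinfeldModule F r) (f : MonicPrime F) (l : ℕ) : F[X] :=
  if l < φ.rankAt f then - (C (φ.constAt f) * (φ.charpolyAt f).coeff l)
  else if l = φ.rankAt f then - C (φ.constAt f)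
  else 0

/-! ### The Goss `L`-series `L(φ^∨, s - 1)` -/

/-- The dual Euler factor `Q_f^∨(x) = P_f(x) / P_f(0) ∈ K[x]`, with `K = F(θ)`. -/
def DrinfeldModule.dualFactor (φ : DrinfeldModule F r) (f : MonicPrime F) : (RatFunc F)[X] :=
  C (algebraMap F[X] (RatFunc F) ((φ.charpolyAt f).coeff 0))⁻¹ *
    (φ.charpolyAt f).map (algebraMap F[X] (RatFunc F))

/-- The Euler factor of `L(φ^∨, s - 1)` at `f` is `Q_f^∨(f ^ (-(s - 1)))⁻¹ = Q_f^∨(f x)⁻¹` with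
`x = f ^ (-s)`; this is that factor as a power series in `x`. -/
def DrinfeldModule.eulerFactor (φ : DrinfeldModule F r) (f : MonicPrime F) :
    PowerSeries (RatFunc F) :=
  (((φ.dualFactor f).comp (C (algebraMap F[X] (RatFunc F) f.1) * X) : (RatFunc F)[X]) :
    PowerSeries (RatFunc F))⁻¹

/-- The coefficient of `a ^ (-s)` in the formal Dirichlet series
`L(φ^∨, s - 1) = ∏_f Q_f^∨(f ^ (-(s - 1)))⁻¹`: expand every Euler factor as a power series in
`f ^ (-s)`, multiply out, and add up the products of terms `c_{f, e f} (f ^ (e f)) ^ (-s)`, over all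
finitely supported choices `e` of exponents, with `∏ f ^ (e f) = a`. -/
def DrinfeldModule.dirichletCoeff (φ : DrinfeldModule F r) (a : F[X]) : RatFunc F :=
  ∑ᶠ (e : MonicPrime F →₀ ℕ) (_ : (e.prod fun f m => f.1 ^ m) = a),
    e.prod fun f m => (φ.eulerFactor f).coeff m

end

end DrinfeldGoss

end

namespace DrinfeldGoss

set_option linter.unusedSectionVars false

/-! Let `S = ∑ c_i τ^i` be the action of θ on L = 𝔽̄_f, with s = r₀ ≥ 1 and c_s ≠ 0. The core is a
matrix over L[X], `frobMatrix`, whose characteristic polynomial is P_f for all λ at once. For a ∈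
F[X] and an a-torsion point y, let G(y) ∈ L[X] be the difference quotient (a(X) - a(S)) / (X - S) at
y, a finite analogue of Anderson's generating functions; here σ, the coefficientwise Frobenius,
extends τ to L[X]. Modulo a one has ∑ c_i σ^i G(y) = X G(y). So the matrix Ψ = (σ^i G(y_j)), for a
torsion basis y_j, satisfies σΨ = ΘΨ with a companion matrix Θ, and σ^d Ψ = Θ_d Ψ with Θ_d =
σ^(d-1)Θ ⋯ σΘ Θ. As G is F[X]-linear modulo a and carries τ^d to σ^d, also σ^d Ψ = ΨM, where M is
the matrix of τ^d on the torsion. A Moore determinant argument shows that Ψ is invertible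
(`genMatrix_isUnit`), so Θ_d and M have the same characteristic polynomial modulo a
(`frobMatrix_charpoly_map`).

The matrix Θ_d does not involve a. Letting deg a grow shows that its characteristic polynomial has
coefficients in F[X] (`exists_map_eq_frobMatrix_charpoly`); taking a = λ^k for all k identifies it
with the one on T_λ. The determinant of Θ gives P_f(0) ∈ F^× f, and a weight count on the entries of
Θ_d bounds the degree of the coefficient of x^l by (1 - l/s) d.

Hence Q_f^∨(f x) = 1 - ∑ b_l f^(l-1) x^l is integral. Inverting it gives a recursion on the values
at powers of f, which is the source of (b) and (c) and propagates the degree bound. Unique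
factorization does the rest. -/

/-! ### Linear independence over the constant field -/

section Moore

variable {F L : Type*} [Field F] [Fintype F] [Field L] [Algebra F L]

/-- The `q`-power polynomial `∑ v_i X ^ (q ^ i)`. -/
noncomputable def linearizedPoly (q : ℕ) {n : ℕ} (v : Fin n → L) : L[X] :=
  ∑ i : Fin n, C (v i) * X ^ (q ^ (i : ℕ))

theorem pow_card_pow_sum {ι : Type*} (s : Finset ι) (a : ι → F) (z : ι → L) (i : ℕ) :
    (∑ k ∈ s, a k • z k) ^ (Fintype.card F ^ i) =
      ∑ k ∈ s, a k • z k ^ (Fintype.card F ^ i) := by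
  rw [← tau_pow_apply (F := F), map_sum]
  exact Finset.sum_congr rfl fun k _ => by rw [map_smul, tau_pow_apply]

/-- By additivity the polynomial vanishes on the whole F-span of the z_k. With N = `Fintype.card ι`,
that span has q^N elements, while the degree is at most q^(N-1). -/
theorem linearizedPoly_eq_zero {ι : Type*} [Fintype ι] {z : ι → L} (hz : LinearIndependent F z)
    (v : Fin (Fintype.card ι) → L)
    (h : ∀ k, ∑ i, v i * z k ^ (Fintype.card F ^ (i : ℕ)) = 0) :
    linearizedPoly (Fintype.card F) v = 0 := by
  classical
  rcases Nat.eq_zero_or_pos (Fintype.card ι) with h0 | hpos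
  · have : IsEmpty (Fin (Fintype.card ι)) := by rw [h0]; infer_instance
    simp [linearizedPoly]
  have hinj : Function.Injective fun a : ι → F => ∑ k, a k • z k := by
    intro a b hab
    have := Fintype.linearIndependent_iff.1 hz (a - b) (by
      simpa [sub_smul, Finset.sum_sub_distrib, sub_eq_zero] using hab)
    exact funext fun k => sub_eq_zero.1 (this k)
  refine eq_zero_of_natDegree_lt_card_of_eval_eq_zero _ hinj (fun a => ?_) ?_
  · rw [linearizedPoly, eval_finsetSum]
    simp only [eval_mul, eval_C, eval_pow, eval_X, pow_card_pow_sum]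
    simp only [Finset.mul_sum]
    rw [Finset.sum_comm]
    refine Finset.sum_eq_zero fun k _ => ?_
    have := congrArg (a k • ·) (h k)
    simpa [Finset.smul_sum] using this
  · rw [Fintype.card_fun]
    have hq : 1 < Fintype.card F := Fintype.one_lt_card
    refine (natDegree_sum_le_of_forall_le (n := Fintype.card F ^ (Fintype.card ι - 1)) _ _
      fun i _ => ?_).trans_lt (Nat.pow_lt_pow_right hq (by lia))
    exact (natDegree_C_mul_X_pow_le _ _).trans (Nat.pow_le_pow_right hq.le (by have := i.2; lia))

theorem linearizedPoly_injective {L : Type*} [Field L] {q : ℕ} (hq : 1 < q) {n : ℕ}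
    {v : Fin n → L} (h : linearizedPoly q v = 0) : v = 0 := by
  funext j
  have := congrArg (fun p => p.coeff (q ^ (j : ℕ))) h
  simp only [linearizedPoly, finsetSum_coeff, coeff_C_mul, coeff_X_pow, coeff_zero] at this
  rw [Finset.sum_eq_single j] at this
  · simpa using this
  · intro i _ hij
    rw [if_neg, mul_zero]
    intro h'
    exact hij (Fin.ext (Nat.pow_right_injective hq h').symm)
  · simp

/-- The vectors `(z_k ^ (q ^ i))_i` are linearly independent if the `z_k` are independent over
`𝔽_q` (nonvanishing of the Moore determinant). -/
theorem eq_zero_of_sum_mul_pow_card_eq_zero {ι : Type*} [Fintype ι] {z : ι → L}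
    (hz : LinearIndependent F z) (u : ι → L)
    (h : ∀ i : ℕ, ∑ k, u k * z k ^ (Fintype.card F ^ i) = 0) : u = 0 := by
  classical
  let N : Matrix ι (Fin (Fintype.card ι)) L := fun k i => z k ^ (Fintype.card F ^ (i : ℕ))
  have hinj : Function.Injective N.mulVecLin := by
    rw [← LinearMap.ker_eq_bot, LinearMap.ker_eq_bot']
    intro v hv
    refine linearizedPoly_injective (Fintype.one_lt_card (α := F)) (linearizedPoly_eq_zero hz v fun k => ?_)
    have := congrFun hv k
    rw [Matrix.mulVecLin_apply] at this
    simpa [N, Matrix.mulVec, dotProduct, mul_comm] using this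
  -- N is square, so it is also surjective. Since u annihilates its image, pairing u with a preimage
  -- of the k-th unit vector reads off u_k = 0.
  have hsurj := (LinearMap.injective_iff_surjective_of_finrank_eq_finrank (by simp)).1 hinj
  funext k
  obtain ⟨v, hv⟩ := hsurj (Pi.single k 1)
  have hdot : u ⬝ᵥ N.mulVec v = 0 := by
    rw [Matrix.dotProduct_mulVec]
    have : Matrix.vecMul u N = 0 := funext fun i => h i
    rw [this, zero_dotProduct]
  rw [← Matrix.mulVecLin_apply, hv] at hdot
  simpa using hdot

end Moore

/-! ### Twisted operators and difference quotients -/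

section Twisted

variable {F : Type*} [Field F]

/-- The operator `y ↦ ∑_{i ≤ s} c_i σ^i(y)` on a commutative ring with an endomorphism `σ`. -/
noncomputable def twistedOp {R : Type*} [CommRing R] [Algebra F R] (σ : R →ₐ[F] R) (c : ℕ → R)
    (s : ℕ) : Module.End F R :=
  ∑ i ∈ Finset.range (s + 1), LinearMap.mulLeft F (c i) * σ.toLinearMap ^ i

theorem toLinearMap_pow_apply {R : Type*} [CommRing R] [Algebra F R] (σ : R →ₐ[F] R) (i : ℕ)
    (y : R) : (σ.toLinearMap ^ i) y = (σ ^ i) y := by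
  induction i generalizing y with
  | zero => rfl
  | succ i ih => rw [pow_succ, pow_succ, Module.End.mul_apply, ih]; rfl

theorem twistedOp_apply {R : Type*} [CommRing R] [Algebra F R] (σ : R →ₐ[F] R) (c : ℕ → R)
    (s : ℕ) (y : R) :
    twistedOp σ c s y = ∑ i ∈ Finset.range (s + 1), c i * (σ ^ i) y := by
  simp [twistedOp, LinearMap.sum_apply, toLinearMap_pow_apply]

theorem algHom_pow_intertwine {R S : Type*} [CommRing R] [Algebra F R] [CommRing S] [Algebra F S]
    {σ : R →ₐ[F] R} {σ' : S →ₐ[F] S} {h : R →ₐ[F] S} (hσ : ∀ y, h (σ y) = σ' (h y)) (i : ℕ)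
    (y : R) : h ((σ ^ i) y) = (σ' ^ i) (h y) := by
  induction i generalizing y with
  | zero => rfl
  | succ i ih => rw [pow_succ, pow_succ, AlgHom.mul_apply, ih, hσ]; rfl

theorem map_twistedOp {R S : Type*} [CommRing R] [Algebra F R] [CommRing S] [Algebra F S]
    {σ : R →ₐ[F] R} {σ' : S →ₐ[F] S} (h : R →ₐ[F] S) (hσ : ∀ y, h (σ y) = σ' (h y))
    (c : ℕ → R) (s : ℕ) (y : R) :
    h (twistedOp σ c s y) = twistedOp σ' (fun i => h (c i)) s (h y) := by
  rw [twistedOp_apply, twistedOp_apply, map_sum]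
  exact Finset.sum_congr rfl fun i _ => by rw [map_mul, algHom_pow_intertwine hσ]

theorem commute_twistedOp_pow {R : Type*} [CommRing R] [Algebra F R] (σ : R →ₐ[F] R) (c : ℕ → R)
    (s d : ℕ) (hc : ∀ i, (σ ^ d) (c i) = c i) :
    Commute (twistedOp σ c s) (σ.toLinearMap ^ d) := by
  refine LinearMap.ext fun y => ?_
  rw [Module.End.mul_apply, Module.End.mul_apply, toLinearMap_pow_apply, toLinearMap_pow_apply,
    twistedOp_apply, twistedOp_apply, map_sum]
  refine Finset.sum_congr rfl fun i _ => ?_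
  rw [map_mul, hc, ← AlgHom.mul_apply, ← AlgHom.mul_apply, ← pow_add, ← pow_add, add_comm]

theorem aeval_intertwine {V W : Type*} [AddCommGroup V] [Module F V] [AddCommGroup W] [Module F W]
    {S : Module.End F V} {T : Module.End F W} (h : V →ₗ[F] W) (hST : ∀ y, h (S y) = T (h y))
    (a : F[X]) (y : V) : h (aeval S a y) = aeval T a (h y) := by
  have hpow : ∀ (n : ℕ) (y : V), h ((S ^ n) y) = (T ^ n) (h y) := by
    intro n
    induction n with
    | zero => intro y; rfl
    | succ n ih => intro y; rw [pow_succ, pow_succ, Module.End.mul_apply, ih, hST]; rfl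
  rw [aeval_eq_sum_range, aeval_eq_sum_range, LinearMap.sum_apply, LinearMap.sum_apply, map_sum]
  exact Finset.sum_congr rfl fun n _ => by
    rw [LinearMap.smul_apply, LinearMap.smul_apply, map_smul, hpow]

/-- The difference quotient `(a(x) - a(t)) / (x - t)`. -/
noncomputable def diffQuot {E : Type*} [Ring E] [Algebra F E] (x t : E) (a : F[X]) : E :=
  ∑ n ∈ Finset.range (a.natDegree + 1),
    a.coeff n • ∑ i ∈ Finset.range n, x ^ i * t ^ (n - 1 - i)

theorem diffQuot_mul_sub {E : Type*} [Ring E] [Algebra F E] {x t : E} (h : Commute x t)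
    (a : F[X]) : diffQuot x t a * (x - t) = aeval x a - aeval t a := by
  rw [diffQuot, Finset.sum_mul, aeval_eq_sum_range, aeval_eq_sum_range, ← Finset.sum_sub_distrib]
  exact Finset.sum_congr rfl fun n _ => by rw [smul_mul_assoc, h.geom_sum₂_mul, smul_sub]

theorem diffQuot_commute {E : Type*} [Ring E] [Algebra F E] {x t u : E} (hx : Commute u x)
    (ht : Commute u t) (a : F[X]) : Commute u (diffQuot x t a) :=
  Commute.sum_right _ _ _ fun _ _ => Commute.smul_right
    (Commute.sum_right _ _ _ fun _ _ => (hx.pow_right _).mul_right (ht.pow_right _)) _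

end Twisted

/-! ### Matrices attached to the relation `∑ c_i σ^i g = x g` -/

section Companion

/-- The companion matrix of `e (x - ∑_{j ≤ n} c_j σ^j)`. -/
def frobCompanion {R : Type*} [CommRing R] (x e : R) (c : ℕ → R) (n : ℕ) :
    Matrix (Fin (n + 1)) (Fin (n + 1)) R := fun i j =>
  if (i : ℕ) = n then e * ((if (j : ℕ) = 0 then x else 0) - c j)
  else if (j : ℕ) = i + 1 then 1 else 0

/-- The twisted product `σ^(k-1)(Θ) ⋯ σ(Θ) Θ`. -/
def twistedProd {R : Type*} [CommRing R] (σ : R →+* R) {m : Type*} [Fintype m] [DecidableEq m]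
    (Θ : Matrix m m R) : ℕ → Matrix m m R
  | 0 => 1
  | k + 1 => (twistedProd σ Θ k).map σ * Θ

theorem twistedProd_map {R S : Type*} [CommRing R] [CommRing S] (σ : R →+* R) (σ' : S →+* S)
    (h : R →+* S) (hσ : ∀ y, h (σ y) = σ' (h y)) {m : Type*} [Fintype m] [DecidableEq m]
    (Θ : Matrix m m R) (k : ℕ) :
    (twistedProd σ Θ k).map h = twistedProd σ' (Θ.map h) k := by
  induction k with
  | zero => simp [twistedProd, Matrix.map_one]
  | succ k ih =>
    rw [twistedProd, twistedProd, Matrix.map_mul, ← ih]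
    congr 1
    ext i j
    simp [hσ]

theorem frobCompanion_map {R S : Type*} [CommRing R] [CommRing S] (h : R →+* S) (x e : R)
    (c : ℕ → R) (n : ℕ) :
    (frobCompanion x e c n).map h = frobCompanion (h x) (h e) (fun i => h (c i)) n := by
  ext i j
  simp only [Matrix.map_apply, frobCompanion]
  split_ifs <;> simp

/-- Apply σ to σ^k Ψ = Θ_k Ψ and substitute σΨ = ΘΨ. The resulting factor depends on Θ alone, not on
Ψ. -/
theorem iterate_map_eq_twistedProd_mul {R : Type*} [CommRing R] (σ : R →+* R) {m m' : Type*}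
    [Fintype m] [DecidableEq m] (Θ : Matrix m m R) (Ψ : Matrix m m' R)
    (h : Ψ.map σ = Θ * Ψ) (k : ℕ) : Ψ.map (σ ^ k) = twistedProd σ Θ k * Ψ := by
  induction k with
  | zero => ext i j; simp [twistedProd]
  | succ k ih =>
    have : Ψ.map (σ ^ (k + 1)) = (Ψ.map (σ ^ k)).map σ := by
      ext i j; simp [pow_succ', RingHom.mul_def]
    rw [this, ih, Matrix.map_mul, h, twistedProd, Matrix.mul_assoc]

/-- The matrix `(σ^i g_j)`. -/
def wronskian {R : Type*} [CommRing R] (σ : R →+* R) {m : Type*} (g : m → R) (n : ℕ) :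
    Matrix (Fin (n + 1)) m R := fun i j => (σ ^ (i : ℕ)) (g j)

/-- Applying σ shifts the rows up by one; the new last row is the relation `hg` solved for σ^(n+1)
g_j, with e the inverse of the leading coefficient. -/
theorem wronskian_map {R : Type*} [CommRing R] (σ : R →+* R) {m : Type*} (g : m → R) {n : ℕ}
    {x e : R} {c : ℕ → R} (he : e * c (n + 1) = 1)
    (hg : ∀ j, ∑ k ∈ Finset.range (n + 2), c k * (σ ^ k) (g j) = x * g j) :
    (wronskian σ g n).map σ = frobCompanion x e c n * wronskian σ g n := by
  ext i j
  have hσ : ∀ k y, σ ((σ ^ k) y) = (σ ^ (k + 1)) y := fun k y => by rw [pow_succ']; rfl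
  rw [Matrix.map_apply, Matrix.mul_apply, wronskian, hσ]
  by_cases hi : (i : ℕ) = n
  · simp only [frobCompanion, hi, if_true, wronskian]
    have h1 := hg j
    rw [Finset.sum_range_succ, ← Fin.sum_univ_eq_sum_range (fun k => c k * (σ ^ k) (g j))] at h1
    have h2 : (∑ k : Fin (n + 1), (if (k : ℕ) = 0 then x else 0) * (σ ^ (k : ℕ)) (g j))
        = x * g j := by
      rw [Finset.sum_eq_single 0] <;> simp +contextual
    simp only [mul_assoc, sub_mul, ← Finset.mul_sum, Finset.sum_sub_distrib, h2]
    rw [← h1]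
    linear_combination (-(σ ^ (n + 1)) (g j)) * he
  · have hlt : (i : ℕ) + 1 < n + 1 := by have := i.2; lia
    rw [Finset.sum_eq_single ⟨i + 1, hlt⟩]
    · simp [frobCompanion, hi, wronskian]
    · intro k _ hk
      have : (k : ℕ) ≠ i + 1 := fun h => hk (Fin.ext h)
      simp [frobCompanion, hi, this]
    · simp

/-- In column 0 only the last row is nonzero, and deleting both leaves the identity matrix. -/
theorem det_frobCompanion {R : Type*} [CommRing R] (x e : R) (c : ℕ → R) (n : ℕ) :
    (frobCompanion x e c n).det = (-1) ^ n * (e * (x - c 0)) := by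
  rw [Matrix.det_succ_column_zero, Finset.sum_eq_single (Fin.last n)]
  · have : (frobCompanion x e c n).submatrix (Fin.last n).succAbove Fin.succ = 1 := by
      ext i j
      have hi : (i : ℕ) ≠ n := i.2.ne
      simp only [Matrix.submatrix_apply, Fin.succAbove_last, frobCompanion, Fin.val_castSucc, hi,
        if_false, Fin.val_succ, Matrix.one_apply, Fin.ext_iff, add_left_inj]
      exact if_congr eq_comm rfl rfl
    rw [this]
    simp [frobCompanion]
  · intro i _ hi
    have : (i : ℕ) ≠ n := fun h => hi (Fin.ext h)
    simp [frobCompanion, this]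
  · simp

theorem det_twistedProd {R : Type*} [CommRing R] (σ : R →+* R) {m : Type*} [Fintype m]
    [DecidableEq m] (Θ : Matrix m m R) (k : ℕ) :
    (twistedProd σ Θ k).det = ∏ i ∈ Finset.range k, (σ ^ i) Θ.det := by
  induction k with
  | zero => simp [twistedProd]
  | succ k ih =>
    rw [twistedProd, Matrix.det_mul, Finset.prod_range_succ']
    have : ((twistedProd σ Θ k).map σ).det = σ (twistedProd σ Θ k).det := by
      rw [RingHom.map_det]; rfl
    rw [this, ih, map_prod]
    congr 1
    exact Finset.prod_congr rfl fun i _ => by rw [pow_succ']; rfl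

theorem charpoly_eq_of_mul_eq_mul {R : Type*} [CommRing R] {m : Type*} [Fintype m]
    [DecidableEq m] {B C P : Matrix m m R} (hP : IsUnit P) (h : B * P = P * C) :
    B.charpoly = C.charpoly := by
  obtain ⟨U, rfl⟩ := hP
  have hdet : IsUnit (U : Matrix m m R).det := (Matrix.isUnit_iff_isUnit_det _).1 U.isUnit
  rw [← Matrix.charpoly_units_conj U C, ← h, Matrix.mul_assoc, Matrix.mul_nonsing_inv _ hdet,
    Matrix.mul_one]

end Companion

/-! ### Generating polynomials of torsion points -/

section Gen

variable {F L : Type*} [Field F] [Fintype F] [Field L] [Algebra F L]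

/-- The coefficientwise `q`-power Frobenius on `L[X]`. -/
noncomputable def coeffFrob (F L : Type*) [Field F] [Fintype F] [Field L] [Algebra F L] :
    L[X] →ₐ[F] L[X] :=
  mapAlgHom (FiniteField.frobeniusAlgHom F L)

theorem frobeniusAlgHom_pow_apply (i : ℕ) (y : L) :
    (FiniteField.frobeniusAlgHom F L ^ i) y = y ^ (Fintype.card F ^ i) := by
  rw [← tau_pow_apply, ← toLinearMap_pow_apply]
  rfl

theorem coeffFrob_C (y : L) :
    CAlgHom (R := F) (FiniteField.frobeniusAlgHom F L y) = coeffFrob F L (CAlgHom (R := F) y) := by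
  simp [coeffFrob, CAlgHom]

theorem coeffFrob_pow_C (i : ℕ) (y : L) :
    (coeffFrob F L ^ i) (C y) = C (y ^ (Fintype.card F ^ i)) := by
  rw [← frobeniusAlgHom_pow_apply]
  exact (algHom_pow_intertwine coeffFrob_C i y).symm

theorem coeffFrob_pow_map (i : ℕ) (p : F[X]) :
    (coeffFrob F L ^ i) (p.map (algebraMap F L)) = p.map (algebraMap F L) := by
  induction i with
  | zero => rfl
  | succ i ih =>
    rw [pow_succ, AlgHom.mul_apply]
    have : coeffFrob F L (p.map (algebraMap F L)) = p.map (algebraMap F L) := by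
      ext m
      simp [coeffFrob]
    rw [this, ih]

theorem coeffFrob_pow_X (i : ℕ) : (coeffFrob F L ^ i) X = X := by
  simpa using coeffFrob_pow_map (L := L) i (X : F[X])

theorem coeff_coeffFrob_pow (i : ℕ) (p : L[X]) (m : ℕ) :
    ((coeffFrob F L ^ i) p).coeff m = p.coeff m ^ (Fintype.card F ^ i) := by
  induction i generalizing p with
  | zero => simp
  | succ i ih =>
    rw [pow_succ, AlgHom.mul_apply, ih, pow_succ', pow_mul]
    simp [coeffFrob]

/-- The operator `∑ c_i σ^i` on `L[X]`, `σ` the coefficientwise Frobenius. -/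
noncomputable def polyTwist (F : Type*) {L : Type*} [Field F] [Fintype F] [Field L] [Algebra F L]
    (c : ℕ → L) (s : ℕ) : Module.End F L[X] :=
  twistedOp (coeffFrob F L) (fun i => C (c i)) s

/-- The operator `∑ c_i τ^i` on `L`. -/
noncomputable abbrev frobTwist (F : Type*) {L : Type*} [Field F] [Fintype F] [Field L]
    [Algebra F L] (c : ℕ → L) (s : ℕ) : Module.End F L :=
  twistedOp (FiniteField.frobeniusAlgHom F L) c s

variable (c : ℕ → L) (s : ℕ)

theorem polyTwist_C (y : L) : polyTwist F c s (C y) = C (frobTwist F c s y) :=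
  (map_twistedOp (CAlgHom (R := F)) coeffFrob_C c s y).symm

theorem polyTwist_pow_C (n : ℕ) (y : L) :
    (polyTwist F c s ^ n) (C y) = C ((frobTwist F c s ^ n) y) := by
  induction n generalizing y with
  | zero => rfl
  | succ n ih => rw [pow_succ, pow_succ, Module.End.mul_apply, polyTwist_C, ih]; rfl

/-- Polynomials over F are fixed by the coefficientwise Frobenius, hence central for all the
operators in use. This is what allows reduction modulo a. -/
theorem commute_mulLeft_map_polyTwist (p : F[X]) :
    Commute (LinearMap.mulLeft F (p.map (algebraMap F L))) (polyTwist F c s) := by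
  refine LinearMap.ext fun g => ?_
  rw [Module.End.mul_apply, Module.End.mul_apply, LinearMap.mulLeft_apply, LinearMap.mulLeft_apply,
    polyTwist, twistedOp_apply, twistedOp_apply, Finset.mul_sum]
  exact Finset.sum_congr rfl fun i _ => by rw [map_mul, coeffFrob_pow_map]; ring

theorem commute_mulLeft_X_polyTwist :
    Commute (LinearMap.mulLeft F (X : L[X])) (polyTwist F c s) := by
  simpa using commute_mulLeft_map_polyTwist c s (X : F[X])

theorem aeval_mulLeft_X (p : F[X]) :
    aeval (LinearMap.mulLeft F (X : L[X])) p = LinearMap.mulLeft F (p.map (algebraMap F L)) := by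
  have := aeval_algHom_apply (Algebra.lmul F L[X]) X p
  rw [aeval_X_left_eq_map] at this
  exact this

/-- The difference quotient of `a` at multiplication by `X` and `∑ c_i σ^i`. -/
noncomputable def polyDiffQuot (a : F[X]) : Module.End F L[X] :=
  diffQuot (LinearMap.mulLeft F X) (polyTwist F c s) a

/-- The generating polynomial of `y ∈ L` with respect to `a`. -/
noncomputable def genPoly (a : F[X]) : L →ₗ[F] L[X] :=
  polyDiffQuot c s a ∘ₗ (CAlgHom (R := F) (A := L)).toLinearMap

theorem genPoly_apply (a : F[X]) (y : L) : genPoly c s a y = polyDiffQuot c s a (C y) := rfl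

theorem polyDiffQuot_sub (a : F[X]) (g : L[X]) :
    polyDiffQuot c s a (X * g - polyTwist F c s g) =
      a.map (algebraMap F L) * g - aeval (polyTwist F c s) a g := by
  have := congrArg (fun E : Module.End F L[X] => E g)
    (diffQuot_mul_sub (commute_mulLeft_X_polyTwist (F := F) c s) a)
  simpa [polyDiffQuot, aeval_mulLeft_X] using this

theorem genPoly_frobTwist (a : F[X]) (y : L) :
    genPoly c s a (frobTwist F c s y) = polyTwist F c s (genPoly c s a y) := by
  rw [genPoly_apply, ← polyTwist_C]
  exact congrArg (fun E : Module.End F L[X] => E (C y))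
    (diffQuot_commute (commute_mulLeft_X_polyTwist c s).symm (Commute.refl _) a).symm.eq

/-- The difference quotient times X - S telescopes to a(X) - a(S), and a(S) kills y. This is the
functional equation of the generating polynomial. -/
theorem X_mul_genPoly (a : F[X]) {y : L} (hy : aeval (frobTwist F c s) a y = 0) :
    X * genPoly c s a y - polyTwist F c s (genPoly c s a y) =
      a.map (algebraMap F L) * C y := by
  have h1 := polyDiffQuot_sub c s a (C y)
  have h2 : aeval (polyTwist F c s) a (C y) = C (aeval (frobTwist F c s) a y) :=
    (aeval_intertwine (CAlgHom (R := F) (A := L)).toLinearMap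
      (fun y => (polyTwist_C c s y).symm) a y).symm
  rw [h2, hy, C_0, sub_zero, map_sub, polyTwist_C] at h1
  rw [← h1, ← genPoly_frobTwist, genPoly_apply, genPoly_apply]
  congr 1
  exact congrArg (fun E : Module.End F L[X] => E (C y))
    (diffQuot_commute (Commute.refl _) (commute_mulLeft_X_polyTwist c s) a).eq

/-- In (x^n - t^n) / (x - t) the coefficient of x^k is t^(n-1-k). The formula serves to show that
G(y) has degree below deg a and that y is its coefficient at deg a - 1. -/
theorem genPoly_coeff (a : F[X]) (y : L) (k : ℕ) :
    (genPoly c s a y).coeff k = ∑ n ∈ Finset.range (a.natDegree + 1),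
      a.coeff n • (if k < n then (frobTwist F c s ^ (n - 1 - k)) y else 0) := by
  have hx : ∀ (i : ℕ) (g : L[X]), (LinearMap.mulLeft F (X : L[X]) ^ i) g = X ^ i * g := by
    intro i g
    rw [LinearMap.pow_mulLeft, LinearMap.mulLeft_apply]
  rw [genPoly_apply, polyDiffQuot, diffQuot, LinearMap.sum_apply, finsetSum_coeff]
  refine Finset.sum_congr rfl fun n _ => ?_
  rw [LinearMap.smul_apply, coeff_smul, LinearMap.sum_apply, finsetSum_coeff]
  simp only [Module.End.mul_apply, polyTwist_pow_C, hx, coeff_X_pow_mul', coeff_C]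
  congr 1
  split_ifs with hk
  · rw [Finset.sum_eq_single k]
    · simp
    · intro i _ hik
      split_ifs <;> first | rfl | lia
    · simp [hk]
  · refine Finset.sum_eq_zero fun i hi => ?_
    rw [Finset.mem_range] at hi
    split_ifs <;> first | rfl | lia

theorem genPoly_coeff_eq_zero (a : F[X]) (y : L) {k : ℕ} (hk : a.natDegree ≤ k) :
    (genPoly c s a y).coeff k = 0 := by
  rw [genPoly_coeff]
  refine Finset.sum_eq_zero fun n hn => ?_
  rw [Finset.mem_range] at hn
  rw [if_neg (by lia), smul_zero]

theorem genPoly_coeff_pred {a : F[X]} (ha : a.Monic) (hd : 0 < a.natDegree) (y : L) :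
    (genPoly c s a y).coeff (a.natDegree - 1) = y := by
  rw [genPoly_coeff, Finset.sum_eq_single a.natDegree]
  · simp [hd, ha.coeff_natDegree]
  · intro n hn hne
    rw [Finset.mem_range] at hn
    rw [if_neg (by lia), smul_zero]
  · simp

/-- The c_i are fixed by the q^d-power map, so σ^d commutes with both operators entering the
difference quotient. -/
theorem genPoly_pow {d : ℕ} (hc : ∀ i, c i ^ (Fintype.card F ^ d) = c i) (a : F[X]) (y : L) :
    genPoly c s a (y ^ (Fintype.card F ^ d)) = (coeffFrob F L ^ d) (genPoly c s a y) := by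
  have h1 : Commute ((coeffFrob F L).toLinearMap ^ d) (LinearMap.mulLeft F (X : L[X])) := by
    refine LinearMap.ext fun g => ?_
    simp only [Module.End.mul_apply, toLinearMap_pow_apply, LinearMap.mulLeft_apply, map_mul,
      coeffFrob_pow_X]
  have h2 : Commute ((coeffFrob F L).toLinearMap ^ d) (polyTwist F c s) :=
    (commute_twistedOp_pow _ _ s d fun i => by rw [coeffFrob_pow_C, hc]).symm
  rw [genPoly_apply, ← coeffFrob_pow_C, genPoly_apply, ← toLinearMap_pow_apply,
    ← toLinearMap_pow_apply]
  exact congrArg (fun E : Module.End F L[X] => E (C y)) (diffQuot_commute h1 h2 a).symm.eq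

/-- Modulo `a`, `genPoly` is `F[X]`-linear on the `a`-torsion. -/
theorem dvd_genPoly_aeval_sub (a p : F[X]) {y : L} (hy : aeval (frobTwist F c s) a y = 0) :
    a.map (algebraMap F L) ∣
      p.map (algebraMap F L) * genPoly c s a y - genPoly c s a (aeval (frobTwist F c s) p y) := by
  have h1 : genPoly c s a (aeval (frobTwist F c s) p y) =
      aeval (polyTwist F c s) p (genPoly c s a y) :=
    aeval_intertwine (genPoly c s a) (genPoly_frobTwist c s a) p y
  -- With D_p the difference quotient of p, p(X)G - p(S)G = D_p((X - S)G) = D_p(a y), and D_p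
  -- commutes with multiplication by a.
  rw [h1, ← polyDiffQuot_sub, X_mul_genPoly c s a hy]
  have h2 : Commute (LinearMap.mulLeft F (a.map (algebraMap F L))) (polyDiffQuot c s p) := by
    refine diffQuot_commute ?_ (commute_mulLeft_map_polyTwist c s a) p
    exact LinearMap.ext fun g => by simp [mul_left_comm]
  exact ⟨_, (congrArg (fun E : Module.End F L[X] => E (C y)) h2.eq).symm⟩

end Gen

/-! ### The Frobenius matrix modulo `a` -/

section FrobMatrix

variable {F L : Type*} [Field F] [Fintype F] [Field L] [Algebra F L]

/-- The ring `L[X] / (a)` for `a ∈ F[X]`. -/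
abbrev GeomQuot (L : Type*) {F : Type*} [Field F] [Field L] [Algebra F L] (a : F[X]) : Type _ :=
  L[X] ⧸ Ideal.span {a.map (algebraMap F L)}

/-- The projection `L[X] → L[X] / (a)`. -/
noncomputable abbrev geomMk (L : Type*) {F : Type*} [Field F] [Field L] [Algebra F L] (a : F[X]) :
    L[X] →+* GeomQuot L a :=
  Ideal.Quotient.mk _

theorem geomMk_eq_iff {a : F[X]} {g h : L[X]} :
    geomMk L a g = geomMk L a h ↔ a.map (algebraMap F L) ∣ g - h := by
  rw [Ideal.Quotient.eq, Ideal.mem_span_singleton]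

theorem geomMk_eq_zero_iff {a : F[X]} {g : L[X]} :
    geomMk L a g = 0 ↔ a.map (algebraMap F L) ∣ g := by
  rw [Ideal.Quotient.eq_zero_iff_mem, Ideal.mem_span_singleton]

/-- The coefficientwise Frobenius on `L[X] / (a)`. -/
noncomputable def geomFrob (L : Type*) {F : Type*} [Field F] [Fintype F] [Field L] [Algebra F L]
    (a : F[X]) : GeomQuot L a →+* GeomQuot L a :=
  Ideal.quotientMap _ (coeffFrob F L).toRingHom (by
    rw [Ideal.span_le, Set.singleton_subset_iff, SetLike.mem_coe, Ideal.mem_comap,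
      Ideal.mem_span_singleton]
    have := coeffFrob_pow_map (L := L) 1 a
    rw [pow_one] at this
    exact dvd_of_eq this.symm)

theorem geomFrob_mk (a : F[X]) (g : L[X]) :
    geomFrob L a (geomMk L a g) = geomMk L a (coeffFrob F L g) :=
  Ideal.quotientMap_mk

theorem geomFrob_pow_mk (a : F[X]) (i : ℕ) (g : L[X]) :
    (geomFrob L a ^ i) (geomMk L a g) = geomMk L a ((coeffFrob F L ^ i) g) := by
  induction i generalizing g with
  | zero => rfl
  | succ i ih =>
    rw [pow_succ, pow_succ, AlgHom.mul_apply, ← ih, ← geomFrob_mk]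
    rfl

/-- The matrix over `L[X]` whose image modulo every `a` is conjugate to the matrix of `τ ^ d` on
the `a`-torsion. -/
noncomputable def frobMatrix (F : Type*) {L : Type*} [Field F] [Fintype F] [Field L] [Algebra F L]
    (c : ℕ → L) (n d : ℕ) : Matrix (Fin (n + 1)) (Fin (n + 1)) L[X] :=
  twistedProd (coeffFrob F L).toRingHom
    (frobCompanion X (C (c (n + 1))⁻¹) (fun i => C (c i)) n) d

variable {c : ℕ → L} {n : ℕ} {a : F[X]}

theorem genPoly_relation {y : L} (hy : aeval (frobTwist F c (n + 1)) a y = 0) :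
    ∑ k ∈ Finset.range (n + 2), geomMk L a (C (c k)) *
      (geomFrob L a ^ k) (geomMk L a (genPoly c (n + 1) a y)) =
        geomMk L a X * geomMk L a (genPoly c (n + 1) a y) := by
  simp only [geomFrob_pow_mk, ← map_mul, ← map_sum]
  rw [eq_comm, geomMk_eq_iff, ← twistedOp_apply (F := F) (coeffFrob F L) (fun i => C (c i))]
  exact ⟨C y, X_mul_genPoly c (n + 1) a hy⟩

/-- The matrix `(σ^i G(y_j))` modulo `a`. -/
noncomputable def genMatrix (c : ℕ → L) (n : ℕ) (a : F[X]) (y : Fin (n + 1) → L) :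
    Matrix (Fin (n + 1)) (Fin (n + 1)) (GeomQuot L a) :=
  wronskian (geomFrob L a) (fun j => geomMk L a (genPoly c (n + 1) a (y j))) n

theorem genMatrix_map_pow (hc : c (n + 1) ≠ 0) {y : Fin (n + 1) → L}
    (hy : ∀ j, aeval (frobTwist F c (n + 1)) a (y j) = 0) (k : ℕ) :
    (genMatrix c n a y).map (geomFrob L a ^ k) =
      (frobMatrix F c n k).map (geomMk L a) * genMatrix c n a y := by
  rw [frobMatrix, twistedProd_map _ (geomFrob L a) (geomMk L a)
    (fun g => (geomFrob_mk a g).symm), frobCompanion_map]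
  exact iterate_map_eq_twistedProd_mul _ _ _ (wronskian_map _ _
    (by rw [← map_mul, ← C_mul, inv_mul_cancel₀ hc, C_1, map_one])
    fun j => genPoly_relation (hy j)) k

/-- An F-relation among the S^k y_j with k < deg a is a relation over F[X] whose coefficients have
degree below deg a; being divisible by a, they vanish. -/
theorem linearIndependent_torsion (hd : a.Monic) {S : Module.End F L} {m : Type*} [Fintype m]
    {y : m → L} (hind : ∀ p : m → F[X], ∑ j, aeval S (p j) (y j) = 0 → ∀ j, a ∣ p j) :
    LinearIndependent F fun jk : m × Fin a.natDegree => (S ^ (jk.2 : ℕ)) (y jk.1) := by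
  rw [Fintype.linearIndependent_iff]
  intro α hα jk
  have h := hind (fun j => ∑ k : Fin a.natDegree, C (α (j, k)) * X ^ (k : ℕ)) (by
    rw [← hα, Fintype.sum_prod_type]
    refine Finset.sum_congr rfl fun j _ => ?_
    rw [map_sum, LinearMap.sum_apply]
    exact Finset.sum_congr rfl fun k _ => by
      simp [Algebra.algebraMap_eq_smul_one]) jk.1
  have h0 := eq_zero_of_dvd_of_degree_lt h (by
    rw [degree_eq_natDegree hd.ne_zero]
    exact degree_sum_fin_lt fun k => α (jk.1, k))
  have := congrArg (fun p => p.coeff (jk.2 : ℕ)) h0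
  simp only [finsetSum_coeff, coeff_C_mul, coeff_X_pow, coeff_zero] at this
  rw [Finset.sum_eq_single jk.2] at this
  · simpa using this
  · intro k _ hk
    rw [if_neg fun h => hk (Fin.ext h.symm), mul_zero]
  · simp

/-- L[X] / (a) is finite over L, so injectivity suffices. If Ψu = 0, then ∑ σ^i(G(y_j)) u_j = 0 for
every i. Write u_j = ∑ u_jk X^k with k < deg a. Since X^k G(y_j) ≡ G(S^k y_j), the polynomial ∑ u_jk
σ^i G(S^k y_j) is divisible by a; its degree is below deg a, so it is zero. Its coefficient at deg a
- 1 is ∑ u_jk (S^k y_j)^(q^i), and the vanishing of these sums for all i forces u_jk = 0 by the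
Moore independence statement. -/
theorem genMatrix_isUnit (hc : c (n + 1) ≠ 0) (ha : a.Monic) {y : Fin (n + 1) → L}
    (hy : ∀ j, aeval (frobTwist F c (n + 1)) a (y j) = 0)
    (hind : ∀ p : Fin (n + 1) → F[X], ∑ j, aeval (frobTwist F c (n + 1)) (p j) (y j) = 0 →
      ∀ j, a ∣ p j) : IsUnit (genMatrix c n a y) := by
  have ha' : (a.map (algebraMap F L)).Monic := ha.map _
  have hfin : Module.Finite L (GeomQuot L a) := ha'.finite_quotient
  have : IsArtinian (GeomQuot L a) (Fin (n + 1) → GeomQuot L a) := by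
    have : IsArtinian L (Fin (n + 1) → GeomQuot L a) := inferInstance
    exact isArtinian_of_tower L this
  rw [← Matrix.isUnit_toLin'_iff, Module.End.isUnit_iff]
  refine IsArtinian.bijective_of_injective_endomorphism _ ?_
  rw [← LinearMap.ker_eq_bot, LinearMap.ker_eq_bot']
  intro u hu
  rw [Matrix.toLin'_apply] at hu
  have hrep : ∀ j, ∃ U : L[X], geomMk L a U = u j ∧ U.natDegree < a.natDegree + 1 ∧
      ∀ k, a.natDegree ≤ k → U.coeff k = 0 := by
    intro j
    obtain ⟨V, hV⟩ := Ideal.Quotient.mk_surjective (u j)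
    have hdeg : (V %ₘ a.map (algebraMap F L)).degree < a.natDegree := by
      have := degree_modByMonic_lt V ha'
      rwa [degree_eq_natDegree ha'.ne_zero, natDegree_map] at this
    refine ⟨V %ₘ a.map (algebraMap F L), ?_, ?_, fun k hk => ?_⟩
    · rw [← hV, geomMk_eq_iff, modByMonic_eq_sub_mul_div]
      exact ⟨-(V /ₘ a.map (algebraMap F L)), by ring⟩
    · exact Nat.lt_succ_of_le (natDegree_le_of_degree_le hdeg.le)
    · exact coeff_eq_zero_of_degree_lt (hdeg.trans_le (by exact_mod_cast hk))
  choose U hU _ hU0 using hrep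
  -- If deg a = 0 the quotient ring is trivial; otherwise the coefficient at deg a - 1 makes sense
  -- below.
  rcases Nat.eq_zero_or_pos a.natDegree with h0 | hpos
  · funext j
    rw [← hU j, show U j = 0 from Polynomial.ext fun k => hU0 j k (by lia)]
    exact map_zero _
  have hsum : ∀ j, U j = ∑ k : Fin a.natDegree, C ((U j).coeff k) * X ^ (k : ℕ) := by
    intro j
    ext k
    rw [finsetSum_coeff]
    simp only [coeff_C_mul, coeff_X_pow]
    by_cases hk : k < a.natDegree
    · rw [Finset.sum_eq_single ⟨k, hk⟩]
      · simp
      · intro k' _ hk'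
        rw [if_neg fun h => hk' (Fin.ext h.symm), mul_zero]
      · simp
    · rw [hU0 j k (by lia)]
      refine (Finset.sum_eq_zero fun k' _ => ?_).symm
      rw [if_neg (by have := k'.2; lia), mul_zero]
  have hkey : ∀ i : ℕ, ∑ j, (geomFrob L a ^ i) (geomMk L a (genPoly c (n + 1) a (y j))) * u j = 0 := by
    intro i
    have h1 : ((genMatrix c n a y).map (geomFrob L a ^ i)).mulVec u = 0 := by
      rw [genMatrix_map_pow hc hy, ← Matrix.mulVec_mulVec, hu, Matrix.mulVec_zero]
    -- Row 0 of σ^i Ψ is (σ^i G(y_j))_j. Since σ^i Ψ is a left multiple of Ψ for every i, the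
    -- exponents i > n are reached too.
    exact congrFun h1 0
  have hz := eq_zero_of_sum_mul_pow_card_eq_zero (linearIndependent_torsion ha hind)
    (fun jk => (U jk.1).coeff jk.2) (by
      intro i
      have h1 := hkey i
      have h2 : geomMk L a (∑ j, ∑ k : Fin a.natDegree, C ((U j).coeff k) *
          (coeffFrob F L ^ i) (genPoly c (n + 1) a ((frobTwist F c (n + 1) ^ (k : ℕ)) (y j)))) = 0 := by
        rw [← h1, map_sum]
        refine Finset.sum_congr rfl fun j _ => ?_
        rw [← hU j, hsum j, geomFrob_pow_mk, ← map_mul, Finset.mul_sum, map_sum, map_sum]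
        refine Finset.sum_congr rfl fun k _ => ?_
        rw [map_mul, ← geomFrob_pow_mk]
        have h3 := geomMk_eq_iff.2 (dvd_genPoly_aeval_sub c (n + 1) a (X ^ (k : ℕ)) (hy j))
        rw [map_pow, aeval_X] at h3
        rw [← h3, geomFrob_pow_mk, map_mul, coeffFrob_pow_map, ← hsum]
        simp only [map_mul, Polynomial.map_pow, map_X]
        ring
      rw [geomMk_eq_zero_iff] at h2
      have h4 := eq_zero_of_dvd_of_degree_lt h2 (by
        rw [degree_eq_natDegree ha'.ne_zero, natDegree_map]
        refine (degree_lt_iff_coeff_zero _ _).2 fun m hm => ?_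
        rw [finsetSum_coeff]
        refine Finset.sum_eq_zero fun j _ => ?_
        rw [finsetSum_coeff]
        refine Finset.sum_eq_zero fun k _ => ?_
        rw [coeff_C_mul, coeff_coeffFrob_pow, genPoly_coeff_eq_zero _ _ _ _ hm,
          zero_pow (pow_ne_zero _ Fintype.card_ne_zero), mul_zero])
      have h5 := congrArg (fun p => p.coeff (a.natDegree - 1)) h4
      simp only [finsetSum_coeff, coeff_C_mul, coeff_coeffFrob_pow,
        genPoly_coeff_pred _ _ ha hpos, coeff_zero] at h5
      rw [Fintype.sum_prod_type]
      exact h5)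
  funext j
  rw [← hU j, hsum j]
  have : ∀ k : Fin a.natDegree, (U j).coeff k = 0 := fun k => congrFun hz (j, k)
  simp [this]

/-- The characteristic polynomial of `τ ^ d` on the `a`-torsion. -/
theorem frobMatrix_charpoly_map (hc : c (n + 1) ≠ 0) (ha : a.Monic) {d : ℕ}
    (hcd : ∀ i, c i ^ (Fintype.card F ^ d) = c i) {y : Fin (n + 1) → L}
    (hy : ∀ j, aeval (frobTwist F c (n + 1)) a (y j) = 0)
    (hind : ∀ p : Fin (n + 1) → F[X], ∑ j, aeval (frobTwist F c (n + 1)) (p j) (y j) = 0 →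
      ∀ j, a ∣ p j)
    (M : Matrix (Fin (n + 1)) (Fin (n + 1)) F[X])
    (hM : ∀ j, y j ^ (Fintype.card F ^ d) = ∑ i, aeval (frobTwist F c (n + 1)) (M i j) (y i)) :
    (frobMatrix F c n d).charpoly.map (geomMk L a) =
      M.charpoly.map ((geomMk L a).comp (mapRingHom (algebraMap F L))) := by
  rw [← Matrix.charpoly_map, ← Matrix.charpoly_map]
  -- Both products equal σ^d Ψ: one by iterating the companion relation, the other by linearity of G
  -- modulo a and its compatibility with τ^d.
  refine charpoly_eq_of_mul_eq_mul (genMatrix_isUnit hc ha hy hind) ?_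
  rw [← genMatrix_map_pow hc hy]
  ext i j
  rw [Matrix.map_apply, Matrix.mul_apply]
  have h1 : (geomFrob L a ^ d) (geomMk L a (genPoly c (n + 1) a (y j))) =
      ∑ k, geomMk L a (genPoly c (n + 1) a (y k)) *
        geomMk L a ((M k j).map (algebraMap F L)) := by
    rw [geomFrob_pow_mk, ← genPoly_pow _ _ hcd, hM, map_sum, map_sum]
    exact Finset.sum_congr rfl fun k _ => by
      rw [← geomMk_eq_iff.2 (dvd_genPoly_aeval_sub c (n + 1) a (M k j) (hy k)), map_mul, mul_comm]
  have h2 : (geomFrob L a ^ d) ((geomFrob L a ^ (i : ℕ)) (geomMk L a (genPoly c (n + 1) a (y j)))) =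
      (geomFrob L a ^ (i : ℕ)) ((geomFrob L a ^ d) (geomMk L a (genPoly c (n + 1) a (y j)))) := by
    change (geomFrob L a ^ d * geomFrob L a ^ (i : ℕ)) _ =
      (geomFrob L a ^ (i : ℕ) * geomFrob L a ^ d) _
    rw [← pow_add, ← pow_add, add_comm]
  refine h2.trans ?_
  rw [h1, map_sum]
  refine Finset.sum_congr rfl fun k _ => ?_
  rw [map_mul, geomFrob_pow_mk a _ ((M k j).map (algebraMap F L)), coeffFrob_pow_map]
  rfl

end FrobMatrix

/-! ### Weights -/

section Weight

variable {R : Type*} [CommRing R]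

/-- Every monomial `t ^ m x ^ l` of `p ∈ R[t][x]` satisfies `s m + d l ≤ e`. -/
def WeightLE (s d : ℕ) (e : ℤ) (p : R[X][X]) : Prop :=
  ∀ l m : ℕ, (p.coeff l).coeff m ≠ 0 → (s * m + d * l : ℤ) ≤ e

namespace WeightLE

variable {s d : ℕ}

theorem of_eq_zero {e : ℤ} {p : R[X][X]} (hp : p = 0) : WeightLE s d e p :=
  fun l m h => absurd (by simp [hp]) h

theorem C_C (e : ℤ) (he : 0 ≤ e) (u : R) : WeightLE s d e (C (C u)) := by
  intro l m h
  rw [coeff_C] at h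
  split_ifs at h with hl
  · rw [coeff_C] at h
    split_ifs at h with hm
    · simp [hl, hm, he]
    · simp at h
  · simp at h

theorem C_X (e : ℤ) (he : s ≤ e) : WeightLE s d e (C (X : R[X])) := by
  intro l m h
  rw [coeff_C] at h
  split_ifs at h with hl
  · rw [coeff_X] at h
    split_ifs at h with hm
    · simpa [hl, ← hm] using he
    · simp at h
  · simp at h

theorem X_weight (e : ℤ) (he : d ≤ e) : WeightLE s d e (X : R[X][X]) := by
  intro l m h
  rw [coeff_X] at h
  split_ifs at h with hl
  · rw [coeff_one] at h
    split_ifs at h with hm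
    · simpa [← hl, hm] using he
    · simp at h
  · simp at h

theorem sum {ι : Type*} {t : Finset ι} {g : ι → R[X][X]} {e : ℤ}
    (h : ∀ i ∈ t, WeightLE s d e (g i)) : WeightLE s d e (∑ i ∈ t, g i) := by
  intro l m hlm
  rw [finsetSum_coeff, finsetSum_coeff] at hlm
  obtain ⟨i, hi, hne⟩ := Finset.exists_ne_zero_of_sum_ne_zero hlm
  exact h i hi l m hne

theorem neg {p : R[X][X]} {e : ℤ} (h : WeightLE s d e p) : WeightLE s d e (-p) := by
  intro l m hlm
  exact h l m (by simpa using hlm)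

theorem sub {p q : R[X][X]} {e : ℤ} (hp : WeightLE s d e p) (hq : WeightLE s d e q) :
    WeightLE s d e (p - q) := by
  intro l m hlm
  by_contra hlt
  have h1 : (p.coeff l).coeff m = 0 := by_contra fun h => hlt (hp l m h)
  have h2 : (q.coeff l).coeff m = 0 := by_contra fun h => hlt (hq l m h)
  exact hlm (by simp [h1, h2])

theorem mul {p q : R[X][X]} {e e' : ℤ} (hp : WeightLE s d e p) (hq : WeightLE s d e' q) :
    WeightLE s d (e + e') (p * q) := by
  intro l m hlm
  rw [coeff_mul, finsetSum_coeff] at hlm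
  obtain ⟨⟨l₁, l₂⟩, hl, hne⟩ := Finset.exists_ne_zero_of_sum_ne_zero hlm
  rw [coeff_mul] at hne
  obtain ⟨⟨m₁, m₂⟩, hm, hne⟩ := Finset.exists_ne_zero_of_sum_ne_zero hne
  rw [Finset.HasAntidiagonal.mem_antidiagonal] at hl hm
  have h1 := hp l₁ m₁ (left_ne_zero_of_mul hne)
  have h2 := hq l₂ m₂ (right_ne_zero_of_mul hne)
  rw [← hl, ← hm]
  push_cast
  linarith

theorem prod {ι : Type*} {t : Finset ι} {g : ι → R[X][X]} {e : ι → ℤ}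
    (h : ∀ i ∈ t, WeightLE s d (e i) (g i)) : WeightLE s d (∑ i ∈ t, e i) (∏ i ∈ t, g i) := by
  classical
  induction t using Finset.induction_on with
  | empty => simpa using C_C (s := s) (d := d) 0 le_rfl (1 : R)
  | insert i t hi ih =>
    rw [Finset.sum_insert hi, Finset.prod_insert hi]
    exact (h i (Finset.mem_insert_self _ _)).mul
      (ih fun k hk => h k (Finset.mem_insert_of_mem hk))

theorem mono {p : R[X][X]} {e e' : ℤ} (h : WeightLE s d e p) (he : e ≤ e') :
    WeightLE s d e' p :=
  fun l m hlm => (h l m hlm).trans he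

/-- In each term of the Leibniz expansion the shifts i - j cancel, because a permutation preserves
the sum of the indices. -/
theorem det {N : ℕ} {A : Matrix (Fin N) (Fin N) R[X][X]} {e : ℤ}
    (h : ∀ i j : Fin N, WeightLE s d (e + (i : ℕ) - (j : ℕ)) (A i j)) : WeightLE s d (N * e) A.det := by
  rw [Matrix.det_apply]
  refine sum fun σ _ => ?_
  have h1 : WeightLE s d (∑ i : Fin N, (e + (σ i : ℕ) - (i : ℕ))) (∏ i, A (σ i) i) :=
    prod fun i _ => h (σ i) i
  have h2 : ∑ i : Fin N, (e + (σ i : ℕ) - (i : ℕ)) = N * e := by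
    rw [Finset.sum_sub_distrib, Finset.sum_add_distrib,
      Equiv.sum_comp σ fun i : Fin N => ((i : ℕ) : ℤ)]
    simp
  rw [h2] at h1
  rcases Int.units_eq_one_or (Equiv.Perm.sign σ) with hσ | hσ
  · rwa [hσ, one_smul]
  · rw [hσ, Units.neg_smul, one_smul]
    exact h1.neg

theorem charpoly {N : ℕ} {A : Matrix (Fin N) (Fin N) R[X]}
    (h : ∀ i j : Fin N, WeightLE s d (d + (i : ℕ) - (j : ℕ)) (C (A i j))) :
    WeightLE s d (N * d) A.charpoly := by
  rw [Matrix.charpoly]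
  refine det fun i j => ?_
  by_cases hij : i = j
  · subst hij
    rw [Matrix.charmatrix_apply_eq]
    exact (X_weight _ (by simp)).sub (h i i)
  · rw [Matrix.charmatrix_apply_ne _ _ _ hij]
    exact (h i j).neg

end WeightLE

end Weight

/-! ### The characteristic polynomial of the Frobenius matrix -/

section Charpoly

variable {F L : Type*} [Field F] [Fintype F] [Field L] [Algebra F L] {c : ℕ → L} {n : ℕ}

theorem weightLE_coeffFrob {s d : ℕ} {e : ℤ} {p : L[X]} (h : WeightLE s d e (C p)) :
    WeightLE s d e (C (coeffFrob F L p)) := by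
  intro l m hlm
  refine h l m fun h0 => hlm ?_
  have := coeff_coeffFrob_pow (F := F) 1 p m
  rw [pow_one] at this
  rw [coeff_C] at h0 ⊢
  split_ifs at h0 ⊢ with hl
  · rw [this, h0, zero_pow (pow_ne_zero _ Fintype.card_ne_zero)]
  · simp

/-- Giving X the weight n + 1 is forced by the corner entry (n, 0), the only one involving X, whose
bound is 1 + n. The bound is 0 at the superdiagonal ones, and negative only for j > i + 1, where the
entry is zero. -/
theorem weightLE_frobCompanion (d : ℕ) (u : L) (i j : Fin (n + 1)) :
    WeightLE (n + 1) d (1 + (i : ℕ) - (j : ℕ))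
      (C (frobCompanion X (C u) (fun i => C (c i)) n i j)) := by
  have hj : ((j : ℕ) : ℤ) ≤ n := by exact_mod_cast Nat.lt_succ_iff.1 j.2
  simp only [frobCompanion]
  split_ifs with h1 h2 h3
  · rw [C_mul, C_sub, ← zero_add (1 + _ - _), h1, h2]
    refine (WeightLE.C_C 0 le_rfl u).mul ((WeightLE.C_X _ ?_).sub (WeightLE.C_C _ ?_ _)) <;>
      push_cast <;> linarith
  · rw [C_mul, zero_sub, C_neg, ← zero_add (1 + _ - _), h1]
    refine (WeightLE.C_C 0 le_rfl u).mul (WeightLE.C_C _ ?_ _).neg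
    linarith
  · exact WeightLE.C_C _ (by rw [h3]; push_cast; linarith) 1
  · exact WeightLE.of_eq_zero C_0

/-- Frobenius does not enlarge the support of a polynomial, and the bounds add up: (k + i - l) + (1
+ l - j) = k + 1 + i - j. -/
theorem weightLE_frobMatrix (d k : ℕ) (i j : Fin (n + 1)) :
    WeightLE (n + 1) d (k + (i : ℕ) - (j : ℕ)) (C (frobMatrix F c n k i j)) := by
  induction k generalizing i j with
  | zero =>
    rw [frobMatrix, twistedProd, Matrix.one_apply]
    split_ifs with hij
    · subst hij
      exact WeightLE.C_C _ (by simp) 1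
    · exact WeightLE.of_eq_zero C_0
  | succ k ih =>
    have hsucc : frobMatrix F c n (k + 1) i j = ∑ l, coeffFrob F L (frobMatrix F c n k i l) *
        frobCompanion X (C (c (n + 1))⁻¹) (fun i => C (c i)) n l j := by
      rw [frobMatrix, twistedProd, Matrix.mul_apply]
      rfl
    rw [hsucc, map_sum]
    refine WeightLE.sum fun l _ => ?_
    rw [C_mul]
    have h1 := weightLE_coeffFrob (F := F) (ih i l)
    have h2 := weightLE_frobCompanion (c := c) d (c (n + 1))⁻¹ l j
    refine (h1.mul h2).mono (le_of_eq ?_)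
    push_cast
    ring

/-- This is the Riemann hypothesis for Frobenius, as a Newton polygon bound on the coefficients:
giving x the weight d makes all of x - Θ_d obey the bound d + i - j. -/
theorem natDegree_coeff_frobMatrix_charpoly (d l : ℕ)
    (h : (frobMatrix F c n d).charpoly.coeff l ≠ 0) :
    (n + 1) * ((frobMatrix F c n d).charpoly.coeff l).natDegree + d * l ≤ (n + 1) * d := by
  have := WeightLE.charpoly (weightLE_frobMatrix (F := F) (c := c) (n := n) d d) l
    ((frobMatrix F c n d).charpoly.coeff l).natDegree (by
      rw [coeff_natDegree]; exact leadingCoeff_ne_zero.2 h)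
  exact_mod_cast this

theorem frobMatrix_det (d : ℕ) : (frobMatrix F c n d).det = ∏ i ∈ Finset.range d,
    (C (((-1) ^ n * (c (n + 1))⁻¹) ^ (Fintype.card F ^ i)) *
      (X - C (c 0 ^ (Fintype.card F ^ i)))) := by
  rw [frobMatrix, det_twistedProd, det_frobCompanion]
  refine Finset.prod_congr rfl fun i _ => ?_
  have h : ∀ (i : ℕ) (g : L[X]),
      ((coeffFrob F L).toRingHom ^ i) g = (coeffFrob F L ^ i) g := by
    intro i g
    induction i generalizing g with
    | zero => rfl
    | succ i ih => rw [pow_succ, pow_succ, AlgHom.mul_apply, ← ih]; rfl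
  rw [h, ← coeffFrob_pow_C, ← coeffFrob_pow_C, ← mul_assoc, map_mul, map_sub, coeffFrob_pow_X]
  simp

/-- The constant term of the characteristic polynomial. -/
theorem exists_coeff_zero_eq {P : F[X][X]} (hc : c (n + 1) ≠ 0) {f : F[X]} (hf : f.Monic)
    (hirr : Irreducible f) (h0 : aeval (c 0) f = 0)
    (hP : P.map (mapRingHom (algebraMap F L)) = (frobMatrix F c n f.natDegree).charpoly) :
    ∃ w : F, w ≠ 0 ∧ P.coeff 0 = C w * f := by
  have h1 : (P.coeff 0).map (algebraMap F L) =
      (-1) ^ (n + 1) * (frobMatrix F c n f.natDegree).det := by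
    rw [Matrix.det_eq_sign_charpoly_coeff, ← hP, coeff_map, Fintype.card_fin, ← mul_assoc,
      ← pow_add, Even.neg_one_pow ⟨n + 1, rfl⟩, one_mul]
    rfl
  rw [frobMatrix_det] at h1
  have hu : ∀ i, ((-1) ^ n * (c (n + 1))⁻¹) ^ (Fintype.card F ^ i) ≠ 0 := fun i => by
    simp [hc]
  have hne : ∀ i ∈ Finset.range f.natDegree,
      (C (((-1) ^ n * (c (n + 1))⁻¹) ^ (Fintype.card F ^ i)) *
      (X - C (c 0 ^ (Fintype.card F ^ i)))) ≠ 0 := fun i _ =>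
    mul_ne_zero (C_ne_zero.2 (hu i)) (X_sub_C_ne_zero _)
  -- The determinant is a product of d polynomials that are linear in X.
  have hdeg : (P.coeff 0).natDegree = f.natDegree := by
    rw [← natDegree_map (algebraMap F L), h1]
    rw [show ((-1 : L[X]) ^ (n + 1)) = C ((-1) ^ (n + 1)) by simp,
      natDegree_C_mul (by simp), natDegree_prod _ _ hne,
      Finset.sum_congr rfl fun i _ => (natDegree_C_mul (hu i)).trans (natDegree_X_sub_C _)]
    simp
  -- The factor with i = 0 vanishes at c_0, whose minimal polynomial is f. Equality of degrees then
  -- leaves a constant cofactor.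
  have hroot : aeval (c 0) (P.coeff 0) = 0 := by
    rw [aeval_def, eval₂_eq_eval_map, h1, eval_mul, eval_prod,
      Finset.prod_eq_zero (Finset.mem_range.2 hirr.natDegree_pos), mul_zero]
    simp
  have hdvd : f ∣ P.coeff 0 := by
    rw [minpoly.eq_of_irreducible_of_monic hirr h0 hf]
    exact minpoly.dvd F _ hroot
  obtain ⟨g, hg⟩ := hdvd
  have hP0 : P.coeff 0 ≠ 0 := fun h => by
    rw [h, natDegree_zero] at hdeg
    exact hirr.natDegree_pos.ne hdeg
  have hg0 : g ≠ 0 := fun h => hP0 (by rw [hg, h, mul_zero])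
  rw [hg, natDegree_mul hf.ne_zero hg0] at hdeg
  rw [eq_C_of_natDegree_eq_zero (show g.natDegree = 0 by lia)] at hg hg0
  exact ⟨g.coeff 0, C_ne_zero.1 hg0, by rw [hg, mul_comm]⟩

/-- `y` is a basis of the `a`-torsion of `L` over `F[X] / (a)` (with respect to the operator `S`),
and `M` describes the action of `τ ^ d` on it. -/
structure IsFrobTorsionBasis {m : Type*} [Fintype m] (S : Module.End F L) (d : ℕ) (a : F[X])
    (y : m → L) (M : Matrix m m F[X]) : Prop where
  torsion : ∀ j, aeval S a (y j) = 0
  indep : ∀ p : m → F[X], ∑ j, aeval S (p j) (y j) = 0 → ∀ j, a ∣ p j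
  frob : ∀ j, y j ^ (Fintype.card F ^ d) = ∑ i, aeval S (M i j) (y i)

theorem IsFrobTorsionBasis.dvd (hc : c (n + 1) ≠ 0) {d : ℕ}
    (hcd : ∀ i, c i ^ (Fintype.card F ^ d) = c i) {a : F[X]} (ha : a.Monic)
    {y : Fin (n + 1) → L} {M : Matrix (Fin (n + 1)) (Fin (n + 1)) F[X]}
    (h : IsFrobTorsionBasis (frobTwist F c (n + 1)) d a y M) (l : ℕ) :
    a.map (algebraMap F L) ∣
      (frobMatrix F c n d).charpoly.coeff l - (M.charpoly.coeff l).map (algebraMap F L) := by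
  have h1 := congrArg (fun p => p.coeff l)
    (frobMatrix_charpoly_map hc ha hcd h.torsion h.indep M h.frob)
  simp only [coeff_map] at h1
  exact geomMk_eq_iff.1 h1

/-- The characteristic polynomial of the Frobenius matrix has coefficients in `F[X]`. -/
theorem exists_map_eq_frobMatrix_charpoly (hc : c (n + 1) ≠ 0) {d : ℕ}
    (hcd : ∀ i, c i ^ (Fintype.card F ^ d) = c i)
    (h : ∀ N : ℕ, ∃ a : F[X], a.Monic ∧ N < a.natDegree ∧
      ∃ (y : Fin (n + 1) → L) (M : Matrix (Fin (n + 1)) (Fin (n + 1)) F[X]),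
        IsFrobTorsionBasis (frobTwist F c (n + 1)) d a y M) :
    ∃ P : F[X][X], P.map (mapRingHom (algebraMap F L)) = (frobMatrix F c n d).charpoly := by
  rw [← mem_lifts, lifts_iff_coeff_lifts]
  intro l
  -- With deg a above the degree of the coefficient, the congruence modulo a with a remainder in
  -- F[X] is an equality.
  obtain ⟨a, ha, hN, y, M, hyM⟩ := h ((frobMatrix F c n d).charpoly.coeff l).natDegree
  have h1 := hyM.dvd hc hcd ha l
  refine ⟨M.charpoly.coeff l %ₘ a, ?_⟩
  have h2 : a.map (algebraMap F L) ∣ (frobMatrix F c n d).charpoly.coeff l -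
      (M.charpoly.coeff l %ₘ a).map (algebraMap F L) := by
    rw [modByMonic_eq_sub_mul_div, Polynomial.map_sub, Polynomial.map_mul]
    obtain ⟨g, hg⟩ := h1
    exact ⟨g + (M.charpoly.coeff l /ₘ a).map (algebraMap F L), by
      linear_combination hg⟩
  refine (sub_eq_zero.1 (eq_zero_of_dvd_of_degree_lt h2 ?_)).symm
  rw [degree_map]
  refine (degree_sub_le _ _).trans_lt (max_lt ?_ ?_)
  · exact degree_le_natDegree.trans_lt (by
      rw [degree_eq_natDegree ha.ne_zero]; exact_mod_cast hN)
  · rw [degree_map]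
    exact degree_modByMonic_lt _ ha

/-- Divisibility between polynomials over F may be tested over L, so the congruence descends to F[X]
/ (a). -/
theorem IsFrobTorsionBasis.map_mk_eq (hc : c (n + 1) ≠ 0) {d : ℕ}
    (hcd : ∀ i, c i ^ (Fintype.card F ^ d) = c i) {P : F[X][X]}
    (hP : P.map (mapRingHom (algebraMap F L)) = (frobMatrix F c n d).charpoly) {a : F[X]}
    (ha : a.Monic) {y : Fin (n + 1) → L} {M : Matrix (Fin (n + 1)) (Fin (n + 1)) F[X]}
    (h : IsFrobTorsionBasis (frobTwist F c (n + 1)) d a y M) :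
    P.map (Ideal.Quotient.mk (Ideal.span {a})) =
      M.charpoly.map (Ideal.Quotient.mk (Ideal.span {a})) := by
  ext1 l
  rw [coeff_map, coeff_map, Ideal.Quotient.eq, Ideal.mem_span_singleton,
    ← map_dvd_map' (algebraMap F L), Polynomial.map_sub]
  have := h.dvd hc hcd ha l
  rwa [← hP, coeff_map] at this

end Charpoly

/-! ### Torsion of `L` -/

section Torsion

variable {F L : Type*} [Field F] [Fintype F] [Field L] [Algebra F L] {c : ℕ → L} {n : ℕ}

/-- As q = 0 in L, only the linear term contributes to the derivative. -/
theorem exists_frobTwist_poly (hc : c (n + 1) ≠ 0) : ∃ p : L[X],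
    p.natDegree = Fintype.card F ^ (n + 1) ∧ derivative p = C (c 0) ∧
      ∀ y, eval y p = frobTwist F c (n + 1) y := by
  have hq : 1 < Fintype.card F := Fintype.one_lt_card
  have hq0 : (Fintype.card F : L) = 0 := by
    have h : (Fintype.card F : F) = 0 := FiniteField.cast_card_eq_zero F
    rw [← map_natCast (algebraMap F L), h, map_zero]
  refine ⟨∑ i ∈ Finset.range (n + 2), C (c i) * X ^ (Fintype.card F ^ i), ?_, ?_, ?_⟩
  · rw [Finset.sum_range_succ, natDegree_add_eq_right_of_natDegree_lt, natDegree_C_mul_X_pow _ _ hc]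
    rw [natDegree_C_mul_X_pow _ _ hc]
    refine (natDegree_sum_le_of_forall_le (n := Fintype.card F ^ n) _ _
      fun i hi => ?_).trans_lt (Nat.pow_lt_pow_right hq (by lia))
    rw [Finset.mem_range] at hi
    exact (natDegree_C_mul_X_pow_le _ _).trans (Nat.pow_le_pow_right hq.le (by lia))
  · rw [derivative_sum, Finset.sum_range_succ']
    have hz : ∀ i, derivative (C (c (i + 1)) * X ^ (Fintype.card F ^ (i + 1))) = 0 := fun i => by
      rw [derivative_C_mul, derivative_X_pow, Nat.cast_pow, hq0, zero_pow (Nat.succ_ne_zero i),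
        C_0, zero_mul, mul_zero]
    simp [hz]
  · intro y
    rw [eval_finsetSum, twistedOp_apply]
    exact Finset.sum_congr rfl fun i _ => by simp [← frobeniusAlgHom_pow_apply (F := F)]

/-- The action of `a ∈ F[X]` is given by a polynomial of degree `q ^ ((n + 1) deg a)` with constant
derivative `a(c_0)`. -/
theorem exists_aeval_frobTwist_poly (hc : c (n + 1) ≠ 0) (a : F[X]) (ha : a ≠ 0) : ∃ p : L[X],
    p.natDegree = Fintype.card F ^ ((n + 1) * a.natDegree) ∧ derivative p = C (aeval (c 0) a) ∧
      ∀ y, eval y p = aeval (frobTwist F c (n + 1)) a y := by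
  have hq : 1 < Fintype.card F := Fintype.one_lt_card
  obtain ⟨t, ht1, ht2, ht3⟩ := exists_frobTwist_poly (F := F) hc
  induction hk : a.natDegree generalizing a with
  | zero =>
    rw [eq_C_of_natDegree_eq_zero hk] at ha ⊢
    refine ⟨C (algebraMap F L (a.coeff 0)) * X, ?_, by simp, fun y => ?_⟩
    · rw [natDegree_C_mul_X _ (by simpa using ha)]; simp
    · simp [Algebra.algebraMap_eq_smul_one]
  | succ k ih =>
    -- Horner's scheme: from a = X b + a(0), the polynomial of a is t∘p plus a linear term, p being
    -- that of b. The degree of t∘p exceeds 1, so the linear term does not affect it.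
    have hdX : a.divX.natDegree = k := by rw [natDegree_divX_eq_natDegree_tsub_one]; lia
    have hb : a.divX ≠ 0 := fun h => by
      have := divX_mul_X_add a
      rw [h, zero_mul, zero_add] at this
      rw [← this, natDegree_C] at hk
      lia
    obtain ⟨p, hp1, hp2, hp3⟩ := ih a.divX hb hdX
    have hcomp : (t.comp p).natDegree = Fintype.card F ^ ((n + 1) * (k + 1)) := by
      rw [natDegree_comp, ht1, hp1, ← pow_add]; congr 1; ring
    refine ⟨t.comp p + C (algebraMap F L (a.coeff 0)) * X, ?_, ?_, fun y => ?_⟩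
    · rw [natDegree_add_eq_left_of_natDegree_lt, hcomp]
      rw [hcomp]
      refine (natDegree_C_mul_le _ _).trans_lt ?_
      rw [natDegree_X]
      exact Nat.one_lt_pow (by positivity) hq
    · have h1 := congrArg (aeval (c 0)) (divX_mul_X_add a)
      rw [map_add, map_mul, aeval_X, aeval_C] at h1
      rw [derivative_add, derivative_comp, ht2, hp2, ← h1]
      simp
    · have h1 := congrArg (aeval (frobTwist F c (n + 1))) (divX_mul_X_add a)
      rw [mul_comm, map_add, map_mul, aeval_X, aeval_C] at h1
      rw [eval_add, eval_comp, hp3, ht3, ← h1]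
      simp [Algebra.algebraMap_eq_smul_one]

theorem frobTwist_divisible [IsAlgClosed L] (hc : c (n + 1) ≠ 0) {a : F[X]} (ha : a ≠ 0) (x : L) :
    ∃ y, aeval (frobTwist F c (n + 1)) a y = x := by
  obtain ⟨p, hp1, -, hp3⟩ := exists_aeval_frobTwist_poly (F := F) hc a ha
  have hdeg : (p - C x).degree ≠ 0 := by
    refine (natDegree_pos_iff_degree_pos.1 ?_).ne'
    rw [natDegree_sub_C, hp1]
    exact pow_pos Fintype.card_pos _
  obtain ⟨y, hy⟩ := IsAlgClosed.exists_root _ hdeg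
  exact ⟨y, by rw [← hp3]; simpa [sub_eq_zero] using hy⟩

/-- The derivative is the nonzero constant a(c_0), so the polynomial is separable and has as many
roots as its degree. -/
theorem card_frobTwist_torsion [IsAlgClosed L] (hc : c (n + 1) ≠ 0) {a : F[X]} (ha : a ≠ 0)
    (h0 : aeval (c 0) a ≠ 0) :
    Nat.card {y : L // aeval (frobTwist F c (n + 1)) a y = 0} =
      Fintype.card F ^ ((n + 1) * a.natDegree) := by
  classical
  obtain ⟨p, hp1, hp2, hp3⟩ := exists_aeval_frobTwist_poly (F := F) hc a ha
  have hsep : p.Separable := by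
    rw [separable_def, hp2]
    exact ⟨0, C (aeval (c 0) a)⁻¹, by rw [zero_mul, zero_add, ← C_mul, inv_mul_cancel₀ h0, C_1]⟩
  have hp0 : p ≠ 0 := hsep.ne_zero
  rw [← hp1, ← card_rootSet_eq_natDegree (K := L) hsep (IsAlgClosed.splits _),
    ← Nat.card_eq_fintype_card]
  refine Nat.card_congr (Equiv.subtypeEquivRight fun y => ?_)
  rw [mem_rootSet_of_ne hp0, ← hp3, coe_aeval_eq_eval]

end Torsion

/-! ### Bases of Tate modules -/

namespace TateModule

section

variable {R : Type*} [CommRing R] {p : R} {M : Type*} [AddCommGroup M] [Module R M]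

/-- Every `p`-torsion element of a `p`-divisible module is the first component of an element of the
Tate module. -/
theorem exists_val_one_eq (hdiv : ∀ x : M, ∃ y, p • y = x) {e : M} (he : p • e = 0) :
    ∃ x : TateModule p M, x.1 1 = e := by
  choose g hg using hdiv
  refine ⟨⟨fun n => Nat.casesOn n 0 fun k => g^[k] e, rfl, fun n => ?_⟩, rfl⟩
  cases n with
  | zero => exact he
  | succ n =>
    change p • g^[n + 1] e = g^[n] e
    rw [Function.iterate_succ_apply', hg]

theorem pow_smul_val_add (x : TateModule p M) (n k : ℕ) : p ^ n • x.1 (k + n) = x.1 k := by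
  induction n with
  | zero => simp
  | succ n ih => rw [pow_succ, mul_smul, ← add_assoc, x.2.2, ih]

variable {ι : Type*} [Fintype ι] {y : ι → TateModule p M}

/-- Multiplying a relation at level n + 1 by p^n yields one at level 1, so a_j = p b_j; the b_j then
satisfy a relation at level n. -/
theorem pow_dvd_of_sum_eq_zero
    (hind : ∀ a : ι → R, ∑ j, a j • (y j).1 1 = 0 → ∀ j, p ∣ a j) (n : ℕ) (a : ι → R)
    (h : ∑ j, a j • (y j).1 n = 0) (j : ι) : p ^ n ∣ a j := by
  induction n generalizing a with
  | zero => simp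
  | succ n ih =>
    have h1 : ∑ j, a j • (y j).1 1 = 0 := by
      have := congrArg (p ^ n • ·) h
      simp only [smul_zero, Finset.smul_sum] at this
      rw [← this]
      refine Finset.sum_congr rfl fun j _ => ?_
      rw [smul_comm, add_comm n 1, pow_smul_val_add]
    choose b hb using hind a h1
    have h2 := ih b (by
      rw [← h]
      refine Finset.sum_congr rfl fun j _ => ?_
      rw [hb j, mul_comm, mul_smul, (y j).2.2])
    rw [hb j, pow_succ']
    exact mul_dvd_mul_left p h2

theorem exists_sum_eq (hspan : ∀ x : M, p • x = 0 → ∃ a : ι → R, ∑ j, a j • (y j).1 1 = x)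
    (n : ℕ) (x : M) (hx : p ^ n • x = 0) : ∃ a : ι → R, ∑ j, a j • (y j).1 n = x := by
  induction n generalizing x with
  | zero =>
    refine ⟨0, ?_⟩
    simp only [pow_zero, one_smul] at hx
    simp [hx]
  | succ n ih =>
    obtain ⟨a, ha⟩ := ih (p • x) (by rw [smul_smul, ← pow_succ, hx])
    obtain ⟨b, hb⟩ := hspan (x - ∑ j, a j • (y j).1 (n + 1)) (by
      rw [smul_sub, ← ha, Finset.smul_sum, sub_eq_zero]
      exact Finset.sum_congr rfl fun j _ => by rw [smul_comm, (y j).2.2])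
    -- The error at level n + 1 is p-torsion, hence a combination of the components at level 1,
    -- which are p^n times those at level n + 1.
    refine ⟨fun j => a j + b j * p ^ n, ?_⟩
    rw [eq_sub_iff_add_eq'] at hb
    rw [← hb, ← Finset.sum_add_distrib]
    refine Finset.sum_congr rfl fun j _ => ?_
    rw [add_smul, mul_smul, add_comm n 1, pow_smul_val_add]

theorem sum_smul_val (α : ι → Completion p) (n : ℕ) :
    (∑ j, α j • y j).1 n = ∑ j, rep (α j) n • (y j).1 n := by
  rw [AddSubgroup.val_finsetSum, Finset.sum_apply]
  rfl

theorem exists_completion_eq (a : ℕ → R) (h : ∀ n, p ^ n ∣ a (n + 1) - a n) :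
    ∃ α : Completion p, ∀ n, AdicCompletion.evalₐ (Ideal.span {p}) n α = Ideal.Quotient.mk _ (a n) := by
  refine ⟨AdicCompletion.mk _ _ (AdicCompletion.AdicCauchySequence.mk _ _ a fun n => ?_),
    fun n => ?_⟩
  · rw [SModEq.sub_mem, smul_eq_mul, Ideal.mul_top, Ideal.span_singleton_pow,
      Ideal.mem_span_singleton, ← dvd_neg, neg_sub]
    exact h n
  · rw [AdicCompletion.evalₐ_mk]
    rfl

/-- Elements of the Tate module whose first components form a basis of the `p`-torsion form a basis
of the Tate module. -/
theorem exists_basis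
    (hind : ∀ a : ι → R, ∑ j, a j • (y j).1 1 = 0 → ∀ j, p ∣ a j)
    (hspan : ∀ x : M, p • x = 0 → ∃ a : ι → R, ∑ j, a j • (y j).1 1 = x) :
    ∃ b : Module.Basis ι (Completion p) (TateModule p M), ⇑b = y := by
  have hli : LinearIndependent (Completion p) y := by
    rw [Fintype.linearIndependent_iff]
    intro α hα j
    refine AdicCompletion.ext_evalₐ fun n => ?_
    have h := pow_dvd_of_sum_eq_zero hind n (fun j => rep (α j) n) (by
      rw [← sum_smul_val, hα, zero_val]) j
    rw [← mk_rep, map_zero, Ideal.Quotient.eq_zero_iff_mem, Ideal.span_singleton_pow,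
      Ideal.mem_span_singleton]
    exact h
  have hsp : ⊤ ≤ Submodule.span (Completion p) (Set.range y) := by
    intro x _
    choose a ha using fun n => exists_sum_eq hspan n (x.1 n) (pow_smul_val x n)
    -- Independence at level n makes the coordinates at successive levels agree modulo p^n, so they
    -- converge in the completion.
    choose α hα using fun j => exists_completion_eq (fun n => a n j) fun n =>
      pow_dvd_of_sum_eq_zero hind n (fun j => a (n + 1) j - a n j) (by
        simp only [sub_smul, Finset.sum_sub_distrib]
        rw [ha, ← x.2.2, ← ha (n + 1), Finset.smul_sum, sub_eq_zero]
        exact Finset.sum_congr rfl fun j _ => by rw [smul_comm, (y j).2.2]) j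
    have hx : x = ∑ j, α j • y j := TateModule.ext fun n => by
      rw [sum_smul_val, ← ha n]
      exact Finset.sum_congr rfl fun j _ => smul_val_congr _ _ (by rw [mk_rep, hα])
    rw [hx]
    exact Submodule.sum_mem _ fun j _ =>
      Submodule.smul_mem _ _ (Submodule.subset_span ⟨j, rfl⟩)
  exact ⟨Module.Basis.mk hli hsp, Module.Basis.coe_mk _ _⟩

/-- Representatives in `R` modulo `p ^ n` of the matrix of an endomorphism. -/
noncomputable def matrixRep [DecidableEq ι] (b : Module.Basis ι (Completion p) (TateModule p M))
    (g : M →ₗ[R] M) (n : ℕ) : Matrix ι ι R :=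
  (LinearMap.toMatrix b b (map g)).map fun α => rep α n

theorem matrixRep_spec [DecidableEq ι] (b : Module.Basis ι (Completion p) (TateModule p M))
    (g : M →ₗ[R] M) (n : ℕ) (j : ι) :
    g ((b j).1 n) = ∑ i, matrixRep b g n i j • (b i).1 n := by
  have h := congrArg (fun x : TateModule p M => x.1 n) (b.sum_repr (map g (b j)))
  simp only [sum_smul_val] at h
  refine Eq.trans ?_ (h.symm.trans (Finset.sum_congr rfl fun i _ => ?_))
  · rfl
  · rw [matrixRep, Matrix.map_apply, LinearMap.toMatrix_apply]

/-- An element of R_p is determined by its components modulo p^n, and forming the characteristic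
polynomial commutes with reduction. -/
theorem charpoly_eq_map [DecidableEq ι] (b : Module.Basis ι (Completion p) (TateModule p M))
    (g : M →ₗ[R] M) (P : R[X])
    (h : ∀ n, P.map (Ideal.Quotient.mk (Ideal.span {p ^ n})) =
      (matrixRep b g n).charpoly.map (Ideal.Quotient.mk (Ideal.span {p ^ n}))) :
    (LinearMap.toMatrix b b (map g)).charpoly = P.map (algebraMap R (Completion p)) := by
  ext1 l
  refine AdicCompletion.ext_evalₐ fun n => ?_
  have h1 : ((LinearMap.toMatrix b b (map g)).charpoly.map
      (AdicCompletion.evalₐ (Ideal.span {p}) n).toRingHom) =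
      P.map (Ideal.Quotient.mk (Ideal.span {p} ^ n)) := by
    have hn := h n
    rw [← Ideal.span_singleton_pow] at hn
    rw [hn, ← Matrix.charpoly_map, ← Matrix.charpoly_map]
    congr 1
    ext i j
    exact (mk_rep _ n).symm
  have h2 := congrArg (fun P => P.coeff l) h1
  simp only [coeff_map] at h2
  rw [coeff_map]
  refine h2.trans ?_
  rw [AlgHom.commutes]
  rfl

end

end TateModule

/-! ### The Tate modules of a Drinfeld module over a finite field -/

section DrinfeldTate

variable {F L : Type*} [Field F] [Fintype F] [Field L] [Algebra F L] {c : ℕ → L} {n : ℕ}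

theorem natCard_quotient_span {a : F[X]} (ha : a.Monic) :
    Nat.card (F[X] ⧸ Ideal.span {a}) = Fintype.card F ^ a.natDegree := by
  have hfin : Module.Finite F (AdjoinRoot a) := ha.finite_adjoinRoot
  have hrank : Module.finrank F (AdjoinRoot a) = a.natDegree := by
    rw [(AdjoinRoot.powerBasis' ha).finrank, AdjoinRoot.powerBasis'_dim]
  have := Module.natCard_eq_pow_finrank (K := F) (V := AdjoinRoot a)
  rw [hrank, Nat.card_eq_fintype_card (α := F)] at this
  exact this

/-- A module whose `p`-torsion, `p` generating a maximal ideal, has as many elements as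
`(R / p) ^ k` has a basis of its `p`-torsion of length `k`. -/
theorem exists_torsion_basis {R : Type*} [CommRing R] {p : R} {M : Type*} [AddCommGroup M]
    [Module R M] (hp : (Ideal.span {p}).IsMaximal) (hfin : 1 < Nat.card (R ⧸ Ideal.span {p})) {k : ℕ}
    (hcard : Nat.card (Submodule.torsionBy R M p) = Nat.card (R ⧸ Ideal.span {p}) ^ k) :
    ∃ e : Fin k → M, (∀ j, p • e j = 0) ∧
      (∀ a : Fin k → R, ∑ j, a j • e j = 0 → ∀ j, p ∣ a j) ∧
      (∀ x : M, p • x = 0 → ∃ a : Fin k → R, ∑ j, a j • e j = x) := by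
  let _ : Field (R ⧸ Ideal.span {p}) := Ideal.Quotient.field _
  have hfin1 : Finite (R ⧸ Ideal.span {p}) := Nat.finite_of_card_ne_zero (by lia)
  have hfin2 : Finite (Submodule.torsionBy R M p) := Nat.finite_of_card_ne_zero (by
    rw [hcard]; exact pow_ne_zero _ (by lia))
  -- The dimension of the torsion over the residue field is read off from its cardinality.
  have hrank : Module.finrank (R ⧸ Ideal.span {p}) (Submodule.torsionBy R M p) = k := by
    have h := Module.natCard_eq_pow_finrank (K := R ⧸ Ideal.span {p})
      (V := Submodule.torsionBy R M p)
    rw [hcard] at h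
    exact (Nat.pow_right_injective hfin h).symm
  let b := Module.finBasisOfFinrankEq (R ⧸ Ideal.span {p}) (Submodule.torsionBy R M p) hrank
  have hsmul : ∀ (a : R) (x : Submodule.torsionBy R M p),
      ((Ideal.Quotient.mk (Ideal.span {p}) a • x : Submodule.torsionBy R M p) : M) = a • (x : M) :=
    fun _ _ => rfl
  refine ⟨fun j => (b j : M), fun j => (Submodule.mem_torsionBy_iff _ _).1 (b j).2,
    fun a ha j => ?_, fun x hx => ?_⟩
  · have h0 : ∑ j, Ideal.Quotient.mk (Ideal.span {p}) (a j) • b j = 0 := by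
      refine Subtype.ext ?_
      rw [AddSubmonoidClass.coe_finsetSum]
      exact ha
    have := Fintype.linearIndependent_iff.1 b.linearIndependent _ h0 j
    rwa [Ideal.Quotient.eq_zero_iff_mem, Ideal.mem_span_singleton] at this
  · choose a ha using fun j => Ideal.Quotient.mk_surjective
      (b.repr ⟨x, (Submodule.mem_torsionBy_iff _ _).2 hx⟩ j)
    refine ⟨a, ?_⟩
    have h := congrArg Subtype.val (b.sum_repr ⟨x, (Submodule.mem_torsionBy_iff _ _).2 hx⟩)
    rw [AddSubmonoidClass.coe_finsetSum] at h
    refine Eq.trans (Finset.sum_congr rfl fun j _ => ?_) h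
    rw [← ha, hsmul]

theorem aeval'_smul_of (S : Module.End F L) (a : F[X]) (x : L) :
    a • Module.AEval'.of S x = Module.AEval'.of S (aeval S a x) :=
  (Module.AEval.of_aeval_smul S a x).symm

/-- Counting the p-torsion gives its dimension n + 1, and divisibility lifts a basis of it to the
Tate module. Independence at every level is recorded because the finite-level comparison with
`frobMatrix` needs it. -/
theorem exists_tate_basis [IsAlgClosed L] (hc : c (n + 1) ≠ 0) {p : F[X]} (hp : p.Monic)
    (hirr : Irreducible p) (h0 : aeval (c 0) p ≠ 0) :
    ∃ b : Module.Basis (Fin (n + 1)) (Completion p)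
      (TateModule p (Module.AEval' (frobTwist F c (n + 1)))),
      ∀ (k : ℕ) (a : Fin (n + 1) → F[X]), ∑ j, a j • (b j).1 k = 0 → ∀ j, p ^ k ∣ a j := by
  set S := frobTwist F c (n + 1) with hS
  have hmax : (Ideal.span {p}).IsMaximal := PrincipalIdealRing.isMaximal_of_irreducible hirr
  have hcardq := natCard_quotient_span hp
  have hcard : Nat.card (Submodule.torsionBy F[X] (Module.AEval' S) p) =
      Nat.card (F[X] ⧸ Ideal.span {p}) ^ (n + 1) := by
    rw [hcardq, ← pow_mul, mul_comm, ← card_frobTwist_torsion hc hp.ne_zero h0]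
    refine (Nat.card_congr ((Module.AEval'.of S).toEquiv.subtypeEquiv fun x => ?_)).symm
    rw [Submodule.mem_torsionBy_iff, LinearEquiv.coe_toEquiv, aeval'_smul_of,
      LinearEquiv.map_eq_zero_iff]
  obtain ⟨e, he, hind, hspan⟩ := exists_torsion_basis hmax (by
    rw [hcardq]; exact Nat.one_lt_pow hirr.natDegree_pos.ne' Fintype.one_lt_card) hcard
  have hdiv : ∀ x : Module.AEval' S, ∃ y, p • y = x := by
    intro x
    obtain ⟨x, rfl⟩ := (Module.AEval'.of S).surjective x
    obtain ⟨y, hy⟩ := frobTwist_divisible (F := F) hc hp.ne_zero x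
    exact ⟨Module.AEval'.of S y, by rw [aeval'_smul_of, hy]⟩
  choose y hy using fun j => TateModule.exists_val_one_eq hdiv (he j)
  have hind' : ∀ a : Fin (n + 1) → F[X], ∑ j, a j • (y j).1 1 = 0 → ∀ j, p ∣ a j := by
    simpa only [hy] using hind
  obtain ⟨b, hb⟩ := TateModule.exists_basis hind' (by simpa only [hy] using hspan)
  refine ⟨b, fun k a => ?_⟩
  rw [hb]
  exact TateModule.pow_dvd_of_sum_eq_zero hind' k a

theorem isFrobTorsionBasis_matrixRep {p : F[X]}
    (b : Module.Basis (Fin (n + 1)) (Completion p)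
      (TateModule p (Module.AEval' (frobTwist F c (n + 1)))))
    (hb : ∀ (k : ℕ) (a : Fin (n + 1) → F[X]), ∑ j, a j • (b j).1 k = 0 → ∀ j, p ^ k ∣ a j)
    {d : ℕ} (g : Module.AEval' (frobTwist F c (n + 1)) →ₗ[F[X]] Module.AEval' (frobTwist F c (n + 1)))
    (hg : ∀ y, g (Module.AEval'.of _ y) = Module.AEval'.of _ (y ^ (Fintype.card F ^ d))) (k : ℕ) :
    IsFrobTorsionBasis (frobTwist F c (n + 1)) d (p ^ k)
      (fun j => (Module.AEval'.of (frobTwist F c (n + 1))).symm ((b j).1 k))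
      (TateModule.matrixRep b g k) := by
  refine ⟨fun j => ?_, fun a ha => hb k a ?_, fun j => ?_⟩
  · rw [← LinearEquiv.map_eq_zero_iff (Module.AEval'.of (frobTwist F c (n + 1))),
      ← aeval'_smul_of, LinearEquiv.apply_symm_apply, TateModule.pow_smul_val]
  · rw [← map_zero (Module.AEval'.of (frobTwist F c (n + 1))), ← ha, map_sum]
    exact Finset.sum_congr rfl fun j _ => by
      rw [← aeval'_smul_of, LinearEquiv.apply_symm_apply]
  · refine (Module.AEval'.of (frobTwist F c (n + 1))).injective ?_
    rw [← hg, LinearEquiv.apply_symm_apply, TateModule.matrixRep_spec, map_sum]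
    exact Finset.sum_congr rfl fun i _ => by
      rw [← aeval'_smul_of, LinearEquiv.apply_symm_apply]

end DrinfeldTate

/-! ### The polynomials `P_f` -/

section FrobCharpoly

variable {F L : Type*} [Field F] [Fintype F] [Field L] [Algebra F L]

theorem exists_monicPrime_ne (f : MonicPrime F) : ∃ lam : MonicPrime F, lam ≠ f := by
  by_cases h : f = ⟨X, monic_X, irreducible_X⟩
  · refine ⟨⟨X - C 1, monic_X_sub_C 1, irreducible_X_sub_C 1⟩, fun h' => ?_⟩
    rw [h] at h'
    have := congrArg (eval 0) (congrArg Subtype.val h')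
    simp at this
  · exact ⟨_, fun h' => h h'.symm⟩

/-- Both polynomials would be the minimal polynomial of x. With x = c_0 this makes the λ-torsion
separable for λ ≠ f. -/
theorem aeval_ne_zero_of_ne {x : L} {f p : F[X]} (hf : f.Monic) (hfi : Irreducible f)
    (h0 : aeval x f = 0) (hp : p.Monic) (hpi : Irreducible p) (hne : p ≠ f) : aeval x p ≠ 0 := by
  intro h
  refine hne ?_
  rw [minpoly.eq_of_irreducible_of_monic hfi h0 hf, minpoly.eq_of_irreducible_of_monic hpi h hp]

/-- The characteristic polynomial of Frobenius on the Tate modules of a Drinfeld module of rank `s`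
over a finite field, its constant term, and the Riemann hypothesis for it. -/
theorem exists_frob_charpoly [IsAlgClosed L] {c : ℕ → L} {s : ℕ} (hs : 1 ≤ s) (hc : c s ≠ 0)
    (f : MonicPrime F) (h0 : aeval (c 0) f.1 = 0)
    (hcd : ∀ i, c i ^ (Fintype.card F ^ f.1.natDegree) = c i)
    {S : Module.End F L} (hS : S = frobTwist F c s) (g : Module.AEval' S →ₗ[F[X]] Module.AEval' S)
    (hg : ∀ y, g (Module.AEval'.of S y) =
      Module.AEval'.of S (y ^ (Fintype.card F ^ f.1.natDegree))) :
    ∃ P : F[X][X], (∀ lam : MonicPrime F, lam ≠ f →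
        ∃ b : Module.Basis (Fin s) (Completion lam.1) (TateModule lam.1 (Module.AEval' S)),
          (LinearMap.toMatrix b b (TateModule.map g)).charpoly =
            P.map (algebraMap F[X] (Completion lam.1))) ∧
      P.Monic ∧ P.natDegree = s ∧ (∃ w : F, w ≠ 0 ∧ P.coeff 0 = C w * f.1) ∧
      ∀ l, P.coeff l ≠ 0 →
        s * (P.coeff l).natDegree + f.1.natDegree * l ≤ s * f.1.natDegree := by
  obtain ⟨n, rfl⟩ : ∃ n, s = n + 1 := ⟨s - 1, by lia⟩
  subst hS
  have hne : ∀ lam : MonicPrime F, lam ≠ f → aeval (c 0) lam.1 ≠ 0 := fun lam hlam =>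
    aeval_ne_zero_of_ne f.2.1 f.2.2 h0 lam.2.1 lam.2.2 fun h => hlam (Subtype.ext h)
  choose b hb using fun (lam : MonicPrime F) (hlam : lam ≠ f) =>
    exists_tate_basis (F := F) hc lam.2.1 lam.2.2 (hne lam hlam)
  have htors := fun (lam : MonicPrime F) (hlam : lam ≠ f) =>
    isFrobTorsionBasis_matrixRep (b lam hlam) (hb lam hlam) g hg
  obtain ⟨P, hP⟩ := exists_map_eq_frobMatrix_charpoly (F := F) hc hcd fun N => by
    -- Powers of a single prime λ ≠ f have unbounded degree, which suffices to descend to F[X]. The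
    -- polynomial P so obtained serves every λ, as `frobMatrix` does not depend on λ.
    obtain ⟨lam, hlam⟩ := exists_monicPrime_ne f
    refine ⟨lam.1 ^ (N + 1), lam.2.1.pow _, ?_, _, _, htors lam hlam (N + 1)⟩
    rw [natDegree_pow]
    exact Nat.lt_of_lt_of_le N.lt_succ_self (Nat.le_mul_of_pos_right _ lam.2.2.natDegree_pos)
  have hinj : Function.Injective (mapRingHom (algebraMap F L)) :=
    map_injective _ (algebraMap F L).injective
  refine ⟨P, fun lam hlam => ⟨b lam hlam, TateModule.charpoly_eq_map _ _ _ fun k =>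
    (htors lam hlam k).map_mk_eq hc hcd hP (lam.2.1.pow k)⟩, ?_, ?_,
    exists_coeff_zero_eq hc f.2.1 f.2.2 h0 hP, fun l hl => ?_⟩
  · refine monic_of_injective hinj ?_
    rw [hP]
    exact Matrix.charpoly_monic _
  · rw [← natDegree_map_eq_of_injective hinj, hP, Matrix.charpoly_natDegree_eq_dim,
      Fintype.card_fin]
  · have h1 : (frobMatrix F c n f.1.natDegree).charpoly.coeff l =
        (P.coeff l).map (algebraMap F L) := by
      rw [← hP, coeff_map]; rfl
    have h2 := natDegree_coeff_frobMatrix_charpoly (F := F) (c := c) (n := n) f.1.natDegree l (by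
      rw [h1]; exact (Polynomial.map_ne_zero_iff (algebraMap F L).injective).2 hl)
    rwa [h1, natDegree_map] at h2

/-- A nonzero a is not divisible by p^(deg a + 1). -/
theorem algebraMap_completion_injective {p : F[X]} (hp : Irreducible p) :
    Function.Injective (algebraMap F[X] (Completion p)) := by
  rw [injective_iff_map_eq_zero]
  intro a ha
  have h := congrArg (AdicCompletion.evalₐ (Ideal.span {p}) (a.natDegree + 1)) ha
  rw [AlgHom.commutes, map_zero, Ideal.Quotient.algebraMap_eq, Ideal.Quotient.eq_zero_iff_mem,
    Ideal.span_singleton_pow, Ideal.mem_span_singleton] at h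
  by_contra ha0
  have h1 := natDegree_le_of_dvd h ha0
  rw [natDegree_pow] at h1
  have h2 := Nat.le_mul_of_pos_right (a.natDegree + 1) hp.natDegree_pos
  lia

end FrobCharpoly

/-! ### The reductions of φ and their Frobenius polynomials. -/

namespace DrinfeldModule

variable {F : Type*} [Field F] [Fintype F] {r : ℕ} (φ : DrinfeldModule F r) (f : MonicPrime F)

theorem redMap_eq_zero_iff (a : F[X]) : redMap f a = 0 ↔ f.1 ∣ a := by
  have h1 : redMap f a = algebraMap (AdjoinRoot f.1) (ResidueClosure f) (AdjoinRoot.mk f.1 a) := rfl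
  rw [h1, map_eq_zero_iff _ (algebraMap (AdjoinRoot f.1) (ResidueClosure f)).injective,
    AdjoinRoot.mk_eq_zero]

theorem rankAt_le : φ.rankAt f ≤ r := by
  classical
  exact Nat.findGreatest_le r

theorem redMap_kappa_rankAt_ne_zero (h : 1 ≤ φ.rankAt f) :
    redMap f (φ.kappa (φ.rankAt f)) ≠ 0 := by
  classical
  rw [Ne, redMap_eq_zero_iff]
  exact Nat.findGreatest_of_ne_zero (P := fun i => ¬ f.1 ∣ φ.kappa i) (n := r) rfl (by lia)

theorem redMap_kappa_eq_zero {i : ℕ} (h : φ.rankAt f < i) (hi : i ≤ r) :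
    redMap f (φ.kappa i) = 0 := by
  classical
  rw [redMap_eq_zero_iff]
  exact not_not.1 (Nat.findGreatest_is_greatest (P := fun i => ¬ f.1 ∣ φ.kappa i) h hi)

/-- Dropping the terms above r₀, which vanish modulo f, gives an operator with nonzero leading
coefficient when r₀ ≥ 1. -/
theorem thetaAction_eq_frobTwist :
    φ.thetaAction (redMap f) = frobTwist F (fun i => redMap f (φ.kappa i)) (φ.rankAt f) := by
  have hle : φ.rankAt f + 1 ≤ r + 1 := Nat.succ_le_succ (φ.rankAt_le f)
  symm
  refine Finset.sum_subset (Finset.range_subset_range.2 hle) fun i hi hi' => ?_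
  rw [Finset.mem_range] at hi hi'
  beta_reduce
  rw [φ.redMap_kappa_eq_zero f (by lia) (by lia), LinearMap.mulLeft_zero_eq_zero, zero_mul]

/-- The polynomial selected by `Classical.epsilon` is the constructed P: the characteristic
polynomial does not depend on the basis, and A embeds into A_λ, so one λ ≠ f determines it. -/
theorem charpolyAt_spec (h : 1 ≤ φ.rankAt f) :
    (∀ lam : MonicPrime F, lam ≠ f → φ.IsFrobCharpoly f lam (φ.charpolyAt f)) ∧
      (φ.charpolyAt f).Monic ∧ (φ.charpolyAt f).natDegree = φ.rankAt f ∧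
      (∃ w : F, w ≠ 0 ∧ (φ.charpolyAt f).coeff 0 = C w * f.1) ∧
      ∀ l, (φ.charpolyAt f).coeff l ≠ 0 →
        φ.rankAt f * ((φ.charpolyAt f).coeff l).natDegree + f.1.natDegree * l ≤
          φ.rankAt f * f.1.natDegree := by
  have h0 : aeval (redMap f (φ.kappa 0)) f.1 = 0 := by
    rw [φ.kappa_zero, aeval_algHom_apply, aeval_X_left_apply, redMap_eq_zero_iff]
  obtain ⟨P, hP, hrest⟩ := exists_frob_charpoly (c := fun i => redMap f (φ.kappa i)) h
    (φ.redMap_kappa_rankAt_ne_zero f h) f h0 (fun i => redMap_pow f _)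
    (φ.thetaAction_eq_frobTwist f) (φ.frob f) (φ.frob_of f)
  have hspec : ∀ lam : MonicPrime F, lam ≠ f → φ.IsFrobCharpoly f lam (φ.charpolyAt f) := by
    rw [charpolyAt, if_pos h]
    exact Classical.epsilon_spec
      (p := fun P => ∀ lam : MonicPrime F, lam ≠ f → φ.IsFrobCharpoly f lam P) ⟨P, hP⟩
  have heq : φ.charpolyAt f = P := by
    obtain ⟨lam, hlam⟩ := exists_monicPrime_ne f
    obtain ⟨b, hb⟩ := hspec lam hlam
    obtain ⟨b', hb'⟩ := hP lam hlam
    have := Module.Free.of_basis b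
    have := Module.Finite.of_basis b
    refine map_injective _ (algebraMap_completion_injective lam.2.2) ?_
    rw [← hb, ← hb', LinearMap.charpoly_toMatrix, LinearMap.charpoly_toMatrix]
  refine ⟨hspec, ?_⟩
  rw [heq]
  exact hrest

end DrinfeldModule

/-! ### Factorization of monic polynomials -/

section Factorization

variable {F : Type*} [Field F]

/-- The monic polynomial with a given factorization. -/
noncomputable def ofExponents (e : MonicPrime F →₀ ℕ) : F[X] :=
  e.prod fun f m => f.1 ^ m

theorem ofExponents_zero : ofExponents (0 : MonicPrime F →₀ ℕ) = 1 := Finsupp.prod_zero_index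

theorem ofExponents_add (e e' : MonicPrime F →₀ ℕ) :
    ofExponents (e + e') = ofExponents e * ofExponents e' :=
  Finsupp.prod_add_index' (fun _ => pow_zero _) fun _ _ _ => pow_add _ _ _

theorem ofExponents_single (f : MonicPrime F) (m : ℕ) :
    ofExponents (Finsupp.single f m) = f.1 ^ m :=
  Finsupp.prod_single_index (pow_zero _)

theorem ofExponents_monic (e : MonicPrime F →₀ ℕ) : (ofExponents e).Monic :=
  monic_prod_of_monic _ _ fun f _ => f.2.1.pow _

theorem natDegree_ofExponents (e : MonicPrime F →₀ ℕ) :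
    (ofExponents e).natDegree = e.sum fun f m => m * f.1.natDegree := by
  rw [ofExponents, Finsupp.prod, natDegree_prod_of_monic _ _ fun f _ => f.2.1.pow _]
  exact Finset.sum_congr rfl fun f _ => natDegree_pow _ _

theorem emultiplicity_ofExponents (e : MonicPrime F →₀ ℕ) (f : MonicPrime F) :
    emultiplicity f.1 (ofExponents e) = e f := by
  classical
  have hf : Prime f.1 := f.2.2.prime
  rw [ofExponents, Finsupp.prod, Finset.emultiplicity_prod hf, Finset.sum_eq_single f]
  · rw [emultiplicity_pow_self hf.ne_zero hf.not_isUnit]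
  · intro g _ hg
    rw [emultiplicity_eq_zero]
    intro h
    have h1 := hf.dvd_of_dvd_pow h
    exact hg (Subtype.ext (eq_of_monic_of_associated g.2.1 f.2.1
      (f.2.2.associated_of_dvd g.2.2 h1).symm))
  · intro h
    rw [Finsupp.notMem_support_iff.1 h, pow_zero]
    exact emultiplicity_eq_zero.2 fun h => hf.not_isUnit (isUnit_of_dvd_one h)

theorem ofExponents_injective : Function.Injective (ofExponents (F := F)) := by
  intro e e' h
  ext f
  have h1 := emultiplicity_ofExponents e f
  rw [h, emultiplicity_ofExponents] at h1
  exact_mod_cast h1.symm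

theorem pow_dvd_ofExponents_iff (e : MonicPrime F →₀ ℕ) (f : MonicPrime F) (j : ℕ) :
    f.1 ^ j ∣ ofExponents e ↔ j ≤ e f := by
  rw [pow_dvd_iff_le_emultiplicity, emultiplicity_ofExponents]
  exact Nat.cast_le

theorem exists_ofExponents_eq {a : F[X]} (ha : a.Monic) : ∃ e, ofExponents e = a := by
  induction hn : a.natDegree using Nat.strong_induction_on generalizing a with
  | _ n ih =>
    by_cases hu : IsUnit a
    · exact ⟨0, by rw [ofExponents_zero, ha.eq_one_of_isUnit hu]⟩
    obtain ⟨g, hgm, hgi, b, rfl⟩ := exists_monic_irreducible_factor a hu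
    have hb : b.Monic := hgm.of_mul_monic_left ha
    have hdeg : b.natDegree < n := by
      rw [← hn, hgm.natDegree_mul hb]
      have := hgi.natDegree_pos
      lia
    obtain ⟨e, he⟩ := ih _ hdeg hb rfl
    exact ⟨Finsupp.single ⟨g, hgm, hgi⟩ 1 + e, by
      rw [ofExponents_add, ofExponents_single, pow_one, he]⟩

end Factorization

/-! ### Multiplicative functions with prescribed values at prime powers -/

section Multiplicative

variable {F : Type*} [Field F] (u : MonicPrime F → ℕ → F[X])

open Classical in
/-- The function on `F(θ)`, vanishing outside the monic polynomials, with value `∏ u_f(e_f)` at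
`∏ f ^ (e_f)`. -/
noncomputable def multExt (y : RatFunc F) : F[X] :=
  if h : ∃ e, algebraMap F[X] (RatFunc F) (ofExponents e) = y then h.choose.prod u else 0

theorem multExt_ofExponents (e : MonicPrime F →₀ ℕ) :
    multExt u (algebraMap F[X] (RatFunc F) (ofExponents e)) = e.prod u := by
  have h : ∃ e', algebraMap F[X] (RatFunc F) (ofExponents e') =
    algebraMap F[X] (RatFunc F) (ofExponents e) := ⟨e, rfl⟩
  rw [multExt, dif_pos h,
    ofExponents_injective (IsFractionRing.injective F[X] (RatFunc F) h.choose_spec)]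

theorem multExt_eq_zero {y : RatFunc F}
    (hy : ¬ ∃ a : F[X], a.Monic ∧ algebraMap F[X] (RatFunc F) a = y) : multExt u y = 0 := by
  rw [multExt, dif_neg]
  rintro ⟨e, he⟩
  exact hy ⟨_, ofExponents_monic e, he⟩

theorem multExt_one : multExt u 1 = 1 := by
  have h := multExt_ofExponents u 0
  rwa [ofExponents_zero, map_one, Finsupp.prod_zero_index] at h

theorem multExt_mul {a b : F[X]} (ha : a.Monic) (hb : b.Monic) (hab : IsCoprime a b) :
    multExt u (algebraMap F[X] (RatFunc F) (a * b)) =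
      multExt u (algebraMap F[X] (RatFunc F) a) * multExt u (algebraMap F[X] (RatFunc F) b) := by
  obtain ⟨e, rfl⟩ := exists_ofExponents_eq ha
  obtain ⟨e', rfl⟩ := exists_ofExponents_eq hb
  rw [← ofExponents_add, multExt_ofExponents, multExt_ofExponents, multExt_ofExponents]
  refine Finsupp.prod_add_index_of_disjoint (Finset.disjoint_left.2 fun f hf hf' => ?_) u
  rw [Finsupp.mem_support_iff] at hf hf'
  have h1 := (pow_dvd_ofExponents_iff e f 1).2 (by lia)
  have h2 := (pow_dvd_ofExponents_iff e' f 1).2 (by lia)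
  rw [pow_one] at h1 h2
  exact f.2.2.not_isUnit (hab.isUnit_of_dvd' h1 h2)

variable {u} (hu : ∀ f, u f 0 = 1)
include hu

theorem multExt_ofExponents_eq_mul (e : MonicPrime F →₀ ℕ) (f : MonicPrime F) :
    multExt u (algebraMap F[X] (RatFunc F) (ofExponents e)) = u f (e f) * (e.erase f).prod u := by
  rw [multExt_ofExponents, Finsupp.mul_prod_erase' e f u hu]

theorem multExt_prime_pow (f : MonicPrime F) (m : ℕ) :
    multExt u (algebraMap F[X] (RatFunc F) (f.1 ^ m)) = u f m := by
  rw [← ofExponents_single, multExt_ofExponents, Finsupp.prod_single_index (hu f)]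

theorem multExt_prime_mul (f : MonicPrime F) (e : MonicPrime F →₀ ℕ) :
    multExt u (algebraMap F[X] (RatFunc F) (f.1 * ofExponents e)) =
      u f (e f + 1) * (e.erase f).prod u := by
  have h : f.1 * ofExponents e = ofExponents (Finsupp.single f 1 + e) := by
    rw [ofExponents_add, ofExponents_single, pow_one]
  have h2 : (Finsupp.single f 1 + e).erase f = e.erase f := by
    rw [Finsupp.erase_add, Finsupp.erase_single, zero_add]
  rw [h, multExt_ofExponents_eq_mul hu _ f, h2]
  simp [add_comm]

/-- If f^j does not divide the argument, the quotient is not a polynomial and the extension by zero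
applies. This convention makes the recursions hold for small exponents as well. -/
theorem multExt_div (f : MonicPrime F) (e : MonicPrime F →₀ ℕ) (j : ℕ) :
    multExt u (algebraMap F[X] (RatFunc F) (ofExponents e) / algebraMap F[X] (RatFunc F) f.1 ^ j) =
      if j ≤ e f then u f (e f - j) * (e.erase f).prod u else 0 := by
  have hf : algebraMap F[X] (RatFunc F) f.1 ^ j ≠ 0 :=
    pow_ne_zero _ (RatFunc.algebraMap_ne_zero f.2.2.ne_zero)
  split_ifs with hj
  · have h : ofExponents e = ofExponents (e - Finsupp.single f j) * f.1 ^ j := by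
      rw [← ofExponents_single, ← ofExponents_add, tsub_add_cancel_of_le]
      exact Finsupp.single_le_iff.2 hj
    have h2 : (e - Finsupp.single f j).erase f = e.erase f := by
      ext g
      by_cases hg : g = f
      · simp [hg]
      · simp [Finsupp.erase_ne hg, Finsupp.single_eq_of_ne hg]
    rw [h, map_mul, map_pow, mul_div_cancel_right₀ _ hf, multExt_ofExponents_eq_mul hu _ f, h2]
    simp
  · refine multExt_eq_zero u ?_
    rintro ⟨a, -, ha⟩
    rw [eq_div_iff hf, ← map_pow, ← map_mul] at ha
    refine hj ((pow_dvd_ofExponents_iff e f j).1 ⟨a, ?_⟩)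
    rw [← IsFractionRing.injective F[X] (RatFunc F) ha, mul_comm]

end Multiplicative

/-! ### The Euler factors -/

namespace DrinfeldModule

variable {F : Type*} [Field F] [Fintype F] {r : ℕ} (φ : DrinfeldModule F r) (f : MonicPrime F)

theorem b_eq_zero {l : ℕ} (h : φ.rankAt f < l) : φ.b f l = 0 := by
  rw [b, if_neg (by lia), if_neg (by lia)]

/-- The polynomial `Q_f^∨(f x) = 1 - ∑ b_ℓ f ^ (ℓ - 1) x ^ ℓ` as a power series over `A`. -/
noncomputable def eulerDenom : PowerSeries F[X] :=
  PowerSeries.mk fun l => if l = 0 then 1 else -(φ.b f l * f.1 ^ (l - 1))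

/-- The coefficients of the Euler factor at `f`. -/
noncomputable def eulerCoeff (m : ℕ) : F[X] :=
  PowerSeries.coeff m (PowerSeries.invOfUnit (φ.eulerDenom f) 1)

theorem eulerDenom_mul : φ.eulerDenom f * PowerSeries.invOfUnit (φ.eulerDenom f) 1 = 1 :=
  PowerSeries.mul_invOfUnit _ _ (by simp [eulerDenom])

/-- Dividing by P_f(0) = w f and substituting f x multiplies the coefficient of x^l by w⁻¹ f^(l-1),
which lies in A for l ≥ 1, with w⁻¹ = c_f. The shift s - 1 is thus what makes μ integral. -/
theorem coeff_dualFactor_comp (l : ℕ) :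
    ((φ.dualFactor f).comp (C (algebraMap F[X] (RatFunc F) f.1) * X)).coeff l =
      algebraMap F[X] (RatFunc F) (PowerSeries.coeff l (φ.eulerDenom f)) := by
  rw [comp_C_mul_X_coeff, dualFactor, coeff_C_mul, coeff_map, eulerDenom, PowerSeries.coeff_mk]
  have hf : algebraMap F[X] (RatFunc F) f.1 ≠ 0 := RatFunc.algebraMap_ne_zero f.2.2.ne_zero
  rcases Nat.eq_zero_or_pos (φ.rankAt f) with h0 | h0
  · have h1 : φ.charpolyAt f = 1 := by rw [charpolyAt, if_neg (by lia)]
    rw [h1]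
    rcases Nat.eq_zero_or_pos l with rfl | hl
    · simp
    · rw [b_eq_zero _ _ (by lia)]
      simp [coeff_one, hl.ne']
  · obtain ⟨-, hmonic, hdeg, ⟨w, hw, hP0⟩, -⟩ := φ.charpolyAt_spec f h0
    have hconst : φ.constAt f = w⁻¹ := by
      rw [constAt, hP0, leadingCoeff_mul, leadingCoeff_C, f.2.1.leadingCoeff, mul_one]
    have hwC : algebraMap F[X] (RatFunc F) (C w) ≠ 0 :=
      RatFunc.algebraMap_ne_zero (C_ne_zero.2 hw)
    have hwinv : (C w⁻¹ : F[X]) * C w = 1 := by rw [← C_mul, inv_mul_cancel₀ hw, C_1]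
    have hwinv' : algebraMap F[X] (RatFunc F) (C w⁻¹) = (algebraMap F[X] (RatFunc F) (C w))⁻¹ :=
      eq_inv_of_mul_eq_one_left (by rw [← map_mul, hwinv, map_one])
    rcases Nat.eq_zero_or_pos l with rfl | hl
    · rw [hP0, map_mul, if_pos rfl, map_one, pow_zero, mul_one]
      exact inv_mul_cancel₀ (mul_ne_zero hwC hf)
    obtain ⟨k, rfl⟩ : ∃ k, l = k + 1 := ⟨l - 1, by lia⟩
    rw [if_neg hl.ne', hP0, b, hconst, Nat.add_sub_cancel]
    rcases lt_trichotomy (k + 1) (φ.rankAt f) with hlt | heq | hgt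
    · rw [if_pos hlt]
      simp only [map_mul, map_neg, map_pow, hwinv']
      field_simp
      ring
    · rw [if_neg (by lia), if_pos heq, heq, ← hdeg, hmonic.coeff_natDegree, hdeg, ← heq]
      simp only [map_mul, map_neg, map_pow, hwinv', map_one]
      field_simp
      ring
    · rw [if_neg (by lia), if_neg (by lia), coeff_eq_zero_of_natDegree_lt (by lia)]
      simp

theorem coeff_eulerFactor (m : ℕ) :
    PowerSeries.coeff m (φ.eulerFactor f) = algebraMap F[X] (RatFunc F) (φ.eulerCoeff f m) := by
  have h1 : (((φ.dualFactor f).comp (C (algebraMap F[X] (RatFunc F) f.1) * X) : (RatFunc F)[X]) :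
      PowerSeries (RatFunc F)) = (φ.eulerDenom f).map (algebraMap F[X] (RatFunc F)) := by
    ext l
    rw [Polynomial.coeff_coe, coeff_dualFactor_comp, PowerSeries.coeff_map]
  have h2 : φ.eulerFactor f = (PowerSeries.invOfUnit (φ.eulerDenom f) 1).map
      (algebraMap F[X] (RatFunc F)) := by
    rw [eulerFactor, h1, eq_comm, PowerSeries.eq_inv_iff_mul_eq_one, ← map_mul, mul_comm,
      eulerDenom_mul, map_one]
    rw [← PowerSeries.coeff_zero_eq_constantCoeff_apply, PowerSeries.coeff_map]
    simp [eulerDenom]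
  rw [h2, PowerSeries.coeff_map, eulerCoeff]

theorem eulerCoeff_zero : φ.eulerCoeff f 0 = 1 := by
  rw [eulerCoeff, PowerSeries.coeff_zero_eq_constantCoeff_apply, PowerSeries.constantCoeff_invOfUnit]
  simp

theorem eulerCoeff_succ (m : ℕ) : φ.eulerCoeff f (m + 1) =
    ∑ l ∈ Finset.Icc 1 (m + 1), φ.b f l * f.1 ^ (l - 1) * φ.eulerCoeff f (m + 1 - l) := by
  have h := congrArg (PowerSeries.coeff (m + 1)) (φ.eulerDenom_mul f)
  rw [PowerSeries.coeff_mul, PowerSeries.coeff_one, if_neg (Nat.succ_ne_zero m),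
    Finset.Nat.sum_antidiagonal_eq_sum_range_succ_mk, Finset.sum_range_succ'] at h
  simp only [eulerDenom, PowerSeries.coeff_mk, if_true, Nat.succ_ne_zero, if_false, one_mul,
    neg_mul, Finset.sum_neg_distrib, Nat.sub_zero, Nat.add_sub_cancel] at h
  have h2 : ∑ l ∈ Finset.Icc 1 (m + 1), φ.b f l * f.1 ^ (l - 1) * φ.eulerCoeff f (m + 1 - l) =
      ∑ l ∈ Finset.range (m + 1), φ.b f (l + 1) * f.1 ^ l * φ.eulerCoeff f (m + 1 - (l + 1)) := by
    have h3 := Finset.sum_Ico_add' (fun l => φ.b f l * f.1 ^ (l - 1) *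
      φ.eulerCoeff f (m + 1 - l)) 0 (m + 1) 1
    rw [← Finset.range_eq_Ico, zero_add, Finset.Ico_add_one_right_eq_Icc] at h3
    simpa only [Nat.add_sub_cancel] using h3.symm
  rw [h2]
  exact (neg_add_eq_zero.1 h).symm

theorem eulerCoeff_succ' (hr : 1 ≤ r) (m : ℕ) : φ.eulerCoeff f (m + 1) =
    φ.eulerCoeff f 1 * φ.eulerCoeff f m + ∑ l ∈ Finset.Icc 2 r, φ.b f l * f.1 ^ (l - 1) *
      (if l - 1 ≤ m then φ.eulerCoeff f (m - (l - 1)) else 0) := by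
  have h1 : φ.eulerCoeff f 1 = φ.b f 1 := by
    rw [eulerCoeff_succ]
    simp [eulerCoeff_zero]
  have hIcc : ∀ N, 1 ≤ N → Finset.Icc 1 N = insert 1 (Finset.Icc 2 N) := fun N hN => by
    ext l
    rw [Finset.mem_insert, Finset.mem_Icc, Finset.mem_Icc]
    lia
  -- Up to N, the sum may be cut at m + 1, where the conditional becomes 0, or at r, beyond which
  -- b_l = 0. Hence both ranges give the same value.
  have h2 : ∀ N, m + 1 ≤ N → r ≤ N → ∀ t, (t = m + 1 ∨ t = r) →
      ∑ l ∈ Finset.Icc 2 N, φ.b f l * f.1 ^ (l - 1) *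
        (if l - 1 ≤ m then φ.eulerCoeff f (m - (l - 1)) else 0) =
      ∑ l ∈ Finset.Icc 2 t, φ.b f l * f.1 ^ (l - 1) *
        (if l - 1 ≤ m then φ.eulerCoeff f (m - (l - 1)) else 0) := by
    intro N hm hN t ht
    refine (Finset.sum_subset (Finset.Icc_subset_Icc_right (by lia)) fun l hl hl' => ?_).symm
    rw [Finset.mem_Icc] at hl hl'
    rcases ht with rfl | rfl
    · rw [if_neg (by lia), mul_zero]
    · have := φ.rankAt_le f
      rw [φ.b_eq_zero f (by lia), zero_mul, zero_mul]
  rw [← h2 (max (m + 1) r) (le_max_left _ _) (le_max_right _ _) r (Or.inr rfl),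
    h2 (max (m + 1) r) (le_max_left _ _) (le_max_right _ _) (m + 1) (Or.inl rfl),
    eulerCoeff_succ, hIcc _ (by lia), Finset.sum_insert (by simp), h1]
  congr 1
  · simp
  · refine Finset.sum_congr rfl fun l hl => ?_
    rw [Finset.mem_Icc] at hl
    rw [if_pos (by lia), show m + 1 - l = m - (l - 1) by lia]

theorem eulerCoeff_eq_zero (h : φ.rankAt f = 0) {m : ℕ} (hm : 1 ≤ m) : φ.eulerCoeff f m = 0 := by
  obtain ⟨k, rfl⟩ : ∃ k, m = k + 1 := ⟨m - 1, by lia⟩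
  rw [eulerCoeff_succ]
  refine Finset.sum_eq_zero fun l hl => ?_
  rw [Finset.mem_Icc] at hl
  rw [φ.b_eq_zero f (by lia), zero_mul, zero_mul]

/-! ### Degree bounds for the Euler coefficients. -/

theorem natDegree_b (h : 1 ≤ φ.rankAt f) {l : ℕ} (hb : φ.b f l ≠ 0) :
    φ.rankAt f * (φ.b f l).natDegree + f.1.natDegree * l ≤ φ.rankAt f * f.1.natDegree := by
  obtain ⟨-, -, -, -, hdeg⟩ := φ.charpolyAt_spec f h
  by_cases hl : l < φ.rankAt f
  · rw [b, if_pos hl] at hb ⊢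
    have h1 := hdeg l fun h0 => hb (by rw [h0, mul_zero, neg_zero])
    rw [natDegree_neg]
    have h2 := natDegree_C_mul_le (φ.constAt f) ((φ.charpolyAt f).coeff l)
    exact (Nat.add_le_add_right (Nat.mul_le_mul_left _ h2) _).trans h1
  · by_cases hl' : l = φ.rankAt f
    · rw [b, if_neg hl, if_pos hl', natDegree_neg, natDegree_C, hl', mul_zero, zero_add, mul_comm]
    · exact absurd (φ.b_eq_zero f (by lia)) hb

/-- The term b_l f^(l-1) u_(m-l) of the recursion has degree at most (1 - l/r₀) d + (l - 1) d + (1 -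
1/r₀)(m - l) d = (1 - 1/r₀) m d, so the bound reproduces itself exactly. -/
theorem natDegree_eulerCoeff (h : 1 ≤ φ.rankAt f) (m : ℕ) :
    φ.rankAt f * (φ.eulerCoeff f m).natDegree + m * f.1.natDegree ≤
      φ.rankAt f * (m * f.1.natDegree) := by
  induction m using Nat.strong_induction_on with
  | _ m ih =>
    cases m with
    | zero => simp [eulerCoeff_zero]
    | succ m =>
      set s := φ.rankAt f
      set d := f.1.natDegree
      have hle : (m + 1) * d ≤ s * ((m + 1) * d) := Nat.le_mul_of_pos_left _ h
      -- Solved for the degree, the bound applies termwise to the sum. By `hle` the truncated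
      -- subtraction is exact, and zero terms, of `natDegree` 0, cause no trouble.
      suffices hs : (φ.eulerCoeff f (m + 1)).natDegree ≤
          (s * ((m + 1) * d) - (m + 1) * d) / s by
        rw [Nat.le_div_iff_mul_le h, mul_comm] at hs
        lia
      rw [eulerCoeff_succ]
      refine natDegree_sum_le_of_forall_le _ _ fun l hl => ?_
      rw [Finset.mem_Icc] at hl
      rw [Nat.le_div_iff_mul_le h]
      by_cases hb : φ.b f l = 0
      · simp [hb]
      refine Nat.le_sub_of_add_le ?_
      have h1 : s * (φ.b f l).natDegree + d * l ≤ s * d := φ.natDegree_b f h hb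
      have h2 := ih (m + 1 - l) (by lia)
      have h3 : (φ.b f l * f.1 ^ (l - 1) * φ.eulerCoeff f (m + 1 - l)).natDegree ≤
          (φ.b f l).natDegree + (l - 1) * d + (φ.eulerCoeff f (m + 1 - l)).natDegree := by
        refine natDegree_mul_le.trans (Nat.add_le_add_right (natDegree_mul_le.trans ?_) _)
        rw [natDegree_pow]
      obtain ⟨k, rfl⟩ : ∃ k, l = k + 1 := ⟨l - 1, by lia⟩
      obtain ⟨j, rfl⟩ : ∃ j, m = k + j := ⟨m - k, by lia⟩
      rw [Nat.add_sub_cancel] at h3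
      rw [show k + j + 1 - (k + 1) = j by lia] at h2 h3 ⊢
      have h4 := Nat.mul_le_mul_left s h3
      rw [Nat.add_sub_cancel, mul_comm _ s]
      nlinarith

/-- By unique factorization a single exponent vector contributes. -/
theorem dirichletCoeff_ofExponents (e : MonicPrime F →₀ ℕ) :
    φ.dirichletCoeff (ofExponents e) =
      algebraMap F[X] (RatFunc F) (e.prod φ.eulerCoeff) := by
  classical
  rw [dirichletCoeff, finsum_eq_single _ e]
  · change ∑ᶠ (_ : ofExponents e = ofExponents e), _ = _
    rw [finsum_eq_if, if_pos rfl, Finsupp.prod, Finsupp.prod, map_prod]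
    exact Finset.prod_congr rfl fun f _ => φ.coeff_eulerFactor f _
  · intro e' he'
    change ∑ᶠ (_ : ofExponents e' = ofExponents e), _ = _
    rw [finsum_eq_if, if_neg fun h => he' (ofExponents_injective h)]

theorem natDegree_eulerCoeff_real (h : 1 ≤ φ.rankAt f) (m : ℕ) :
    ((φ.eulerCoeff f m).natDegree : ℝ) ≤ (1 - 1 / (φ.rankAt f : ℝ)) * m * f.1.natDegree := by
  have h1 : (φ.rankAt f : ℝ) * (φ.eulerCoeff f m).natDegree + m * f.1.natDegree ≤
      φ.rankAt f * (m * f.1.natDegree) := by exact_mod_cast φ.natDegree_eulerCoeff f h m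
  have hs : (0 : ℝ) < φ.rankAt f := by exact_mod_cast h
  rw [← mul_le_mul_iff_right₀ hs]
  have h2 : (φ.rankAt f : ℝ) * ((1 - 1 / (φ.rankAt f : ℝ)) * m * f.1.natDegree) =
      φ.rankAt f * (m * f.1.natDegree) - m * f.1.natDegree := by
    field_simp
  rw [h2]
  linarith

theorem natDegree_eulerCoeff_real_le_rank (hr : 1 ≤ r) (m : ℕ) :
    ((φ.eulerCoeff f m).natDegree : ℝ) ≤ (1 - 1 / (r : ℝ)) * (m * f.1.natDegree) := by
  have hr' : (1 : ℝ) ≤ r := by exact_mod_cast hr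
  have hmd : (0 : ℝ) ≤ m * f.1.natDegree := by positivity
  have hnonneg : (0 : ℝ) ≤ 1 - 1 / (r : ℝ) := by
    rw [sub_nonneg, div_le_one (by linarith)]
    exact hr'
  rcases Nat.eq_zero_or_pos (φ.rankAt f) with h0 | h0
  · rcases Nat.eq_zero_or_pos m with rfl | hm
    · simp [eulerCoeff_zero]
    · rw [φ.eulerCoeff_eq_zero f h0 hm, natDegree_zero, Nat.cast_zero]
      exact mul_nonneg hnonneg hmd
  · refine (φ.natDegree_eulerCoeff_real f h0 m).trans ?_
    rw [mul_assoc]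
    refine mul_le_mul_of_nonneg_right (sub_le_sub_left ?_ _) hmd
    exact one_div_le_one_div_of_le (by exact_mod_cast h0) (by exact_mod_cast φ.rankAt_le f)

theorem natDegree_prod_eulerCoeff (hr : 1 ≤ r) (e : MonicPrime F →₀ ℕ) :
    ((e.prod φ.eulerCoeff).natDegree : ℝ) ≤ (1 - 1 / (r : ℝ)) * (ofExponents e).natDegree := by
  rw [natDegree_ofExponents, Finsupp.prod, Finsupp.sum]
  refine (Nat.cast_le.2 (natDegree_prod_le _ _)).trans ?_
  push_cast
  rw [Finset.mul_sum]
  exact Finset.sum_le_sum fun f _ => φ.natDegree_eulerCoeff_real_le_rank f hr _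

/-- The coefficients of the formal Dirichlet series, as a function on `F(θ)`. -/
noncomputable def mu : RatFunc F → F[X] := multExt φ.eulerCoeff

theorem mu_div (e : MonicPrime F →₀ ℕ) (j : ℕ) :
    φ.mu (algebraMap F[X] (RatFunc F) (ofExponents e) / algebraMap F[X] (RatFunc F) f.1 ^ j) =
      (if j ≤ e f then φ.eulerCoeff f (e f - j) else 0) * (e.erase f).prod φ.eulerCoeff := by
  rw [mu, multExt_div φ.eulerCoeff_zero, ite_mul, zero_mul]

theorem mu_prime : φ.mu (algebraMap F[X] (RatFunc F) f.1) = φ.eulerCoeff f 1 := by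
  have h := multExt_prime_pow φ.eulerCoeff_zero f 1
  rwa [pow_one] at h

theorem mu_ofExponents (e : MonicPrime F →₀ ℕ) :
    φ.mu (algebraMap F[X] (RatFunc F) (ofExponents e)) =
      φ.eulerCoeff f (e f) * (e.erase f).prod φ.eulerCoeff :=
  multExt_ofExponents_eq_mul φ.eulerCoeff_zero e f

/-- The prime-to-f part of a contributes the same factor to every term; what remains is the
recursion for the Euler coefficients at f. -/
theorem mu_prime_mul (hr : 1 ≤ r) {a : F[X]} (ha : a.Monic) :
    φ.mu (algebraMap F[X] (RatFunc F) (f.1 * a)) =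
      φ.mu (algebraMap F[X] (RatFunc F) f.1) * φ.mu (algebraMap F[X] (RatFunc F) a) +
        ∑ l ∈ Finset.Icc 2 r, φ.b f l * f.1 ^ (l - 1) *
          φ.mu (algebraMap F[X] (RatFunc F) a / algebraMap F[X] (RatFunc F) f.1 ^ (l - 1)) := by
  obtain ⟨e, he⟩ := exists_ofExponents_eq ha
  have h1 : φ.mu (algebraMap F[X] (RatFunc F) (f.1 * a)) =
      φ.eulerCoeff f (e f + 1) * (e.erase f).prod φ.eulerCoeff := by
    rw [← he]
    exact multExt_prime_mul φ.eulerCoeff_zero f e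
  rw [h1, ← he, mu_prime, mu_ofExponents φ f, φ.eulerCoeff_succ' f hr, add_mul, Finset.sum_mul,
    mul_assoc]
  refine congrArg _ (Finset.sum_congr rfl fun l _ => ?_)
  rw [mu_div, mul_assoc]

theorem mu_prime_zpow (hr : 1 ≤ r) (m : ℤ) (hm : -(r : ℤ) < m) :
    φ.mu (algebraMap F[X] (RatFunc F) f.1 ^ (m + r)) =
      φ.mu (algebraMap F[X] (RatFunc F) f.1) *
          φ.mu (algebraMap F[X] (RatFunc F) f.1 ^ (m + r - 1)) +
        ∑ l ∈ Finset.Icc 2 r,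
          φ.b f l * f.1 ^ (l - 1) * φ.mu (algebraMap F[X] (RatFunc F) f.1 ^ (m + r - l)) := by
  have hf : algebraMap F[X] (RatFunc F) f.1 ≠ 0 := RatFunc.algebraMap_ne_zero f.2.2.ne_zero
  -- The condition m > -r says that k = m + r - 1 ≥ 0, so this is the recursion for a = f^k.
  obtain ⟨k, hk⟩ : ∃ k : ℕ, m + r = k + 1 := ⟨(m + r - 1).toNat, by lia⟩
  have h := φ.mu_prime_mul f hr (f.2.1.pow k)
  rw [hk, add_sub_cancel_right, zpow_natCast, ← map_pow]
  rw [← pow_succ'] at h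
  have h1 : algebraMap F[X] (RatFunc F) f.1 ^ ((k : ℤ) + 1) =
      algebraMap F[X] (RatFunc F) (f.1 ^ (k + 1)) := by
    rw [map_pow, ← zpow_natCast]
    push_cast
    rfl
  rw [h1, h]
  congr 1
  refine Finset.sum_congr rfl fun l hl => ?_
  rw [Finset.mem_Icc] at hl
  congr 2
  rw [map_pow, ← zpow_natCast, ← zpow_natCast, ← zpow_sub₀ hf]
  congr 1
  push_cast [Nat.cast_sub (show 1 ≤ l by lia)]
  ring

end DrinfeldModule

end DrinfeldGoss

open DrinfeldGoss in
theorem lemma3p3 {F : Type*} [Field F] [Fintype F] {r : ℕ} (hr : 1 ≤ r)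
    (φ : DrinfeldModule F r) :
    -- The polynomials `P_f` and the constants `c_f` entering the definition of `μ` are well defined.
    (∀ f : MonicPrime F, 1 ≤ φ.rankAt f →
      (∀ lam : MonicPrime F, lam ≠ f → φ.IsFrobCharpoly f lam (φ.charpolyAt f)) ∧
      φ.constAt f ≠ 0 ∧ (φ.charpolyAt f).coeff 0 = C (φ.constAt f)⁻¹ * f.1) ∧
    -- The function `μ`, with values in `A = F[X]` and extended by zero from `A_+` to `K`.
    ∃ μ : RatFunc F → F[X],
      (∀ a : F[X], a.Monic →
        algebraMap F[X] (RatFunc F) (μ (algebraMap F[X] (RatFunc F) a)) = φ.dirichletCoeff a) ∧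
      (∀ y : RatFunc F, (¬ ∃ a : F[X], a.Monic ∧ algebraMap F[X] (RatFunc F) a = y) → μ y = 0) ∧
      -- (a)
      (μ 1 = 1 ∧ ∀ a b : F[X], a.Monic → b.Monic → IsCoprime a b →
        μ (algebraMap F[X] (RatFunc F) (a * b)) =
          μ (algebraMap F[X] (RatFunc F) a) * μ (algebraMap F[X] (RatFunc F) b)) ∧
      -- (b)
      (∀ (f : MonicPrime F) (m : ℤ), -(r : ℤ) < m →
        μ (algebraMap F[X] (RatFunc F) f.1 ^ (m + r)) =
          μ (algebraMap F[X] (RatFunc F) f.1) *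
              μ (algebraMap F[X] (RatFunc F) f.1 ^ (m + r - 1)) +
            ∑ l ∈ Finset.Icc 2 r,
              φ.b f l * f.1 ^ (l - 1) * μ (algebraMap F[X] (RatFunc F) f.1 ^ (m + r - l))) ∧
      -- (c)
      (∀ (f : MonicPrime F) (a : F[X]), a.Monic →
        μ (algebraMap F[X] (RatFunc F) (f.1 * a)) =
          μ (algebraMap F[X] (RatFunc F) f.1) * μ (algebraMap F[X] (RatFunc F) a) +
            ∑ l ∈ Finset.Icc 2 r, φ.b f l * f.1 ^ (l - 1) *
              μ (algebraMap F[X] (RatFunc F) a / algebraMap F[X] (RatFunc F) f.1 ^ (l - 1))) ∧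
      -- (d) at prime powers: `μ (f ^ m) = 0` if `r₀ = 0`, and a degree bound if `r₀ ≥ 1`
      (∀ (f : MonicPrime F) (m : ℕ), 1 ≤ m →
        (φ.rankAt f = 0 → μ (algebraMap F[X] (RatFunc F) (f.1 ^ m)) = 0) ∧
        (1 ≤ φ.rankAt f → μ (algebraMap F[X] (RatFunc F) (f.1 ^ m)) ≠ 0 →
          ((μ (algebraMap F[X] (RatFunc F) (f.1 ^ m))).natDegree : ℝ) ≤
            (1 - 1 / (φ.rankAt f : ℝ)) * m * f.1.natDegree)) ∧
      -- (d) in general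
      (∀ a : F[X], a.Monic → μ (algebraMap F[X] (RatFunc F) a) ≠ 0 →
        ((μ (algebraMap F[X] (RatFunc F) a)).natDegree : ℝ) ≤
          (1 - 1 / (r : ℝ)) * a.natDegree) := by
  refine ⟨fun f hf => ?_, φ.mu, fun a ha => ?_, fun y hy => multExt_eq_zero _ hy,
    ⟨multExt_one _, fun a b ha hb hab => multExt_mul _ ha hb hab⟩,
    fun f m hm => φ.mu_prime_zpow f hr m hm, fun f a ha => φ.mu_prime_mul f hr ha,
    fun f m hm => ?_, fun a ha _ => ?_⟩
  · obtain ⟨hspec, -, -, ⟨w, hw, hP0⟩, -⟩ := φ.charpolyAt_spec f hf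
    have hconst : φ.constAt f = w⁻¹ := by
      rw [DrinfeldModule.constAt, hP0, leadingCoeff_mul, leadingCoeff_C, f.2.1.leadingCoeff,
        mul_one]
    exact ⟨hspec, by rw [hconst]; exact inv_ne_zero hw, by rw [hconst, inv_inv, hP0]⟩
  · obtain ⟨e, rfl⟩ := exists_ofExponents_eq ha
    rw [φ.dirichletCoeff_ofExponents, DrinfeldModule.mu, multExt_ofExponents]
  · rw [DrinfeldModule.mu, multExt_prime_pow (u := φ.eulerCoeff) φ.eulerCoeff_zero]
    exact ⟨fun h0 => φ.eulerCoeff_eq_zero f h0 hm,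
      fun h0 _ => φ.natDegree_eulerCoeff_real f h0 m⟩
  · obtain ⟨e, rfl⟩ := exists_ofExponents_eq ha
    rw [DrinfeldModule.mu, multExt_ofExponents]
    exact φ.natDegree_prod_eulerCoeff hr e
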